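/- An instance of heterogeneous TSP (HTSP) consists of a finite set $V$ with rational metric distances $d$ (distance $0$ between distinct vertices is allowed), a depot $r\in V$, and $k\ge 1$ vehicles whose speeds $\lambda_1,\dots,\lambda_k$ are non-negative integral powers of $2$. A solution is a family of tours $\tau_1,\dots,\tau_k$ (closed walks starting and ending at $r$, possibly staying at $r$) such that every vertex lies on some tour; its makespan is $\max_i d(\tau_i)/\lambda_i$, where $d(\tau_i)$ is the length of $\tau_i$, and $\mathrm{OPT}$ is the minimum makespan. Let $\mu_j$ be the number of vehicles of speed $2^j$. For reals $M,\alpha,\beta\ge 0$, a finite collection $\bigcup_{i\ge 0}\mathcal T_i$ of trees containing $r$ in the complete graph on $V$, which together cover $V$, is called $(\alpha,\beta)$-assignable with respect to $M$ if, writing $d(T)$ for the total length of the edges of $T$ and $d(\mathcal T_j)=\sum_{T\in\mathcal T_j}d(T)$, 1. $d(T)\le \alpha\, 2^i M$ for every $i\ge 0$ and every $T\in\mathcal T_i$; 2. $\sum_{j\ge i} d(\mathcal T_j)\le \beta M\sum_{j\ge 0,\ j\ge i-1}2^j\mu_j$ for every $i\ge 0$. **Lemma.** There is a polynomial-time algorithm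 (a random access machine with logarithmic cost, whose running time is bounded by a fixed polynomial in the bit length of its input) which, given an HTSP instance as above and a collection of $r$-rooted trees, outputs a solution to HTSP such that, for all $M,\alpha,\beta\ge 0$ with respect to which the collection is $(\alpha,\beta)$-assignable, the makespan is at most $(4\alpha+2\beta)M$. (The algorithm is only required to succeed on collections that are assignable for some such values.) Consequently, for every real $c$ with $M\le c\cdot\mathrm{OPT}$, the solution is a $c(4\alpha+2\beta)$-approximation, i.e. its makespan is at most $c(4\alpha+2\beta)\cdot \mathrm{OPT}$; in particular it is a $(4\alpha+2\beta)$-approximation if $M\le\mathrm{OPT}$. -/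

import Mathlib

/-! ## Machine model: random access machine with logarithmic cost

A structured (`while`-program) random access machine over the natural numbers.  It has registers
and memory banks addressed by computed indices.  Programs are finite objects, so a program
mentions only finitely many registers and banks.  Every elementary operation is charged one unit
plus the bit lengths of all numbers (addresses included) it handles. -/

namespace RAM

/-- `reg x` is the content of register `x`; `mem a i` is the content of cell `i` of bank `a`. -/
structure State where
  reg : ℕ → ℕ
  mem : ℕ → ℕ → ℕ

/-- Arithmetic expressions (truncated subtraction, floor division). -/
inductive Expr where
  | lit (c : ℕ)
  | reg (x : ℕ)
  | cell (a : ℕ) (i : Expr)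
  | add (e f : Expr)
  | sub (e f : Expr)
  | mul (e f : Expr)
  | div (e f : Expr)

/-- Value of an expression in a state. -/
def Expr.val (s : State) : Expr → ℕ
  | .lit c => c
  | .reg x => s.reg x
  | .cell a i => s.mem a (i.val s)
  | .add e f => e.val s + f.val s
  | .sub e f => e.val s - f.val s
  | .mul e f => e.val s * f.val s
  | .div e f => e.val s / f.val s

/-- Logarithmic cost of evaluating an expression. -/
def Expr.cost (s : State) : Expr → ℕ
  | .lit c => 1 + Nat.size c
  | .reg x => 1 + Nat.size (s.reg x)
  | .cell a i => 1 + i.cost s + Nat.size (i.val s) + Nat.size (s.mem a (i.val s))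
  | .add e f => 1 + e.cost s + f.cost s + Nat.size (e.val s) + Nat.size (f.val s)
  | .sub e f => 1 + e.cost s + f.cost s + Nat.size (e.val s) + Nat.size (f.val s)
  | .mul e f => 1 + e.cost s + f.cost s + Nat.size (e.val s) + Nat.size (f.val s)
  | .div e f => 1 + e.cost s + f.cost s + Nat.size (e.val s) + Nat.size (f.val s)

/-- Programs. A test succeeds when the expression is nonzero. -/
inductive Prog where
  | assign (x : ℕ) (e : Expr)
  | store (a : ℕ) (i e : Expr)
  | seq (p q : Prog)
  | ite (e : Expr) (p q : Prog)
  | loop (e : Expr) (p : Prog)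

def State.setReg (s : State) (x v : ℕ) : State :=
  { s with reg := Function.update s.reg x v }

def State.setMem (s : State) (a i v : ℕ) : State :=
  { s with mem := Function.update s.mem a (Function.update (s.mem a) i v) }

/-- `Exec p s s' t`: started in state `s`, the program `p` halts in state `s'` after a computation
of total cost `t`. -/
inductive Exec : Prog → State → State → ℕ → Prop where
  | assign (x : ℕ) (e : Expr) (s : State) :
      Exec (.assign x e) s (s.setReg x (e.val s)) (1 + e.cost s + Nat.size (e.val s))
  | store (a : ℕ) (i e : Expr) (s : State) :
      Exec (.store a i e) s (s.setMem a (i.val s) (e.val s))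
        (1 + i.cost s + e.cost s + Nat.size (i.val s) + Nat.size (e.val s))
  | seq {p q : Prog} {s s₁ s₂ : State} {t₁ t₂ : ℕ} :
      Exec p s s₁ t₁ → Exec q s₁ s₂ t₂ → Exec (.seq p q) s s₂ (t₁ + t₂)
  | ite_true {e : Expr} {p q : Prog} {s s' : State} {t : ℕ} :
      e.val s ≠ 0 → Exec p s s' t → Exec (.ite e p q) s s' (1 + e.cost s + t)
  | ite_false {e : Expr} {p q : Prog} {s s' : State} {t : ℕ} :
      e.val s = 0 → Exec q s s' t → Exec (.ite e p q) s s' (1 + e.cost s + t)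
  | loop_done {e : Expr} {p : Prog} {s : State} :
      e.val s = 0 → Exec (.loop e p) s s (1 + e.cost s)
  | loop_step {e : Expr} {p : Prog} {s s₁ s₂ : State} {t₁ t₂ : ℕ} :
      e.val s ≠ 0 → Exec p s s₁ t₁ → Exec (.loop e p) s₁ s₂ t₂ →
        Exec (.loop e p) s s₂ (1 + e.cost s + t₁ + t₂)

/-- Number of bits needed to write down a list of natural numbers
(binary notation, one separator per entry). -/
def bitLength (x : List ℕ) : ℕ := (x.map fun a => Nat.size a + 1).sum

/-- Initially bank `0` holds the input word and register `0` its length; all else is `0`. -/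
def init (x : List ℕ) : State where
  reg := fun y => if y = 0 then x.length else 0
  mem := fun a i => if a = 0 then x.getD i 0 else 0

/-- Upon halting, the output is in bank `1` and register `0` holds its length. -/
def output (s : State) : List ℕ := (List.range (s.reg 0)).map (s.mem 1)

/-- On input `x` the program `p` halts with output `y`, in time `t`
(emitting the output is charged as well). -/
def Runs (p : Prog) (x y : List ℕ) (t : ℕ) : Prop :=
  ∃ s t₀, Exec p (init x) s t₀ ∧ output s = y ∧ t = t₀ + bitLength y

end RAM

/-! ## Heterogeneous TSP -/

/-- An instance of HTSP whose speeds are powers of two: `n` vertices with rational distances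
`d`, a depot `r` and `k ≥ 1` vehicles, the `i`-th one having speed `2 ^ lvl i`.
Distinct vertices at distance `0` are allowed. -/
structure HTSP where
  n : ℕ
  d : Fin n → Fin n → ℚ
  d_self : ∀ u, d u u = 0
  d_nonneg : ∀ u v, 0 ≤ d u v
  d_symm : ∀ u v, d u v = d v u
  d_triangle : ∀ u v w, d u w ≤ d u v + d v w
  r : Fin n
  k : ℕ
  k_pos : 0 < k
  lvl : Fin k → ℕ

namespace HTSP

variable (I : HTSP)

/-- The speed of vehicle `i`. -/
def speed (i : Fin I.k) : ℕ := 2 ^ I.lvl i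

/-- `μ_j`, the number of vehicles of speed `2 ^ j`. -/
def mu (j : ℕ) : ℕ := (Finset.univ.filter fun i => I.lvl i = j).card

/-- The largest `j` such that some vehicle has speed `2 ^ j`. -/
def maxLvl : ℕ := Finset.univ.sup I.lvl

/-- Length of the walk visiting the listed vertices in this order. -/
def walkLength : List (Fin I.n) → ℚ
  | u :: v :: l => I.d u v + walkLength (v :: l)
  | _ => 0

/-- A tour starts and ends at the depot (the tour `[r]` stays there). -/
def IsTour (τ : List (Fin I.n)) : Prop :=
  τ.head? = some I.r ∧ τ.getLast? = some I.r

/-- A solution: one tour for each vehicle, together covering every vertex. -/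
def IsSolution (τ : Fin I.k → List (Fin I.n)) : Prop :=
  (∀ i, I.IsTour (τ i)) ∧ ∀ v, ∃ i, v ∈ τ i

/-- The maximum completion time `max_i d(τ_i) / λ_i`. -/
noncomputable def makespan (τ : Fin I.k → List (Fin I.n)) : ℝ :=
  ⨆ i, (I.walkLength (τ i) : ℝ) / (I.speed i : ℝ)

/-- The optimal value. -/
noncomputable def opt : ℝ := sInf {x | ∃ τ, I.IsSolution τ ∧ x = I.makespan τ}

/-- `τ` is a `ρ`-approximate solution. -/
def IsApprox (ρ : ℝ) (τ : Fin I.k → List (Fin I.n)) : Prop :=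
  I.IsSolution τ ∧ I.makespan τ ≤ ρ * I.opt

/-- A set of edges of the complete graph on the vertices, listed in any order. -/
abbrev EdgeList := List (Fin I.n × Fin I.n)

/-- The graph on all vertices whose edges are those listed. -/
def graph (T : I.EdgeList) : SimpleGraph (Fin I.n) :=
  SimpleGraph.fromRel fun u v => (u, v) ∈ T

/-- The edges `T` (no loop, none listed twice) form a tree containing the depot: they contain no
cycle and all of them are connected to the depot. Without edges it is the tree `{r}`. -/
def IsRootedTree (T : I.EdgeList) : Prop :=
  (∀ e ∈ T, e.1 ≠ e.2) ∧ (T.map fun e => s(e.1, e.2)).Nodup ∧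
    (I.graph T).IsAcyclic ∧ ∀ e ∈ T, (I.graph T).Reachable I.r e.1

/-- The vertices of the tree rooted at the depot with edge set `T`. -/
def treeVerts (T : I.EdgeList) : Set (Fin I.n) := {v | (I.graph T).Reachable I.r v}

/-- The total length `d(T)` of a set of edges. -/
def edgeLength (T : I.EdgeList) : ℚ := (T.map fun e => I.d e.1 e.2).sum

/-- A finite collection of edge sets partitioned into classes `𝒯_0, 𝒯_1, …`; the classes beyond
the end of the list are empty. -/
abbrev Collection := List (List I.EdgeList)

/-- The total length `d(𝒯_i)` of class `i`. -/
def classLength (C : I.Collection) (i : ℕ) : ℚ := ((C.getD i []).map I.edgeLength).sum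

/-- `(α, β)`-assignable collections of trees rooted at the depot, with respect to the value `M`.
In the last sum `i - 1` is truncated at `0`, which is harmless as `j ≥ 0`; the summands with
`j > maxLvl` vanish. -/
def Assignable (M α β : ℝ) (C : I.Collection) : Prop :=
  (∀ 𝒯 ∈ C, ∀ T ∈ 𝒯, I.IsRootedTree T) ∧
  (∀ v, ∃ 𝒯 ∈ C, ∃ T ∈ 𝒯, v ∈ I.treeVerts T) ∧
  (∀ i, ∀ T ∈ C.getD i [], (I.edgeLength T : ℝ) ≤ α * 2 ^ i * M) ∧
  (∀ i, ∑ j ∈ Finset.Ico i C.length, (I.classLength C j : ℝ) ≤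
    β * M * ∑ j ∈ Finset.Icc (i - 1) I.maxLvl, (2 : ℝ) ^ j * (I.mu j : ℝ))

/-- Encoding of an instance: number of vertices, distance matrix (numerators and denominators,
row by row), depot, number of vehicles, speeds. Numbers are written in binary. -/
def encode : List ℕ :=
  [I.n] ++
  (List.finRange I.n).flatMap (fun u =>
    (List.finRange I.n).flatMap fun v => [(I.d u v).num.natAbs, (I.d u v).den]) ++
  [(I.r : ℕ), I.k] ++ (List.finRange I.k).map I.speed

/-- Encoding of an edge set: number of edges, then the end points of the edges. -/
def encodeTree (T : I.EdgeList) : List ℕ :=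
  [T.length] ++ T.flatMap fun e => [(e.1 : ℕ), (e.2 : ℕ)]

/-- Encoding of a collection: number of classes, then for each class the number of its trees
followed by the trees. -/
def encodeCollection (C : I.Collection) : List ℕ :=
  [C.length] ++ C.flatMap fun 𝒯 => [𝒯.length] ++ 𝒯.flatMap I.encodeTree

/-- The input word: the instance followed by the collection. -/
def encodeInput (C : I.Collection) : List ℕ := I.encode ++ I.encodeCollection C

/-- Encoding of one tour per vehicle: for each vehicle the number of listed vertices, then the
vertices. -/
def encodeTours (τ : Fin I.k → List (Fin I.n)) : List ℕ :=
  (List.finRange I.k).flatMap fun i => [(τ i).length] ++ (τ i).map fun v => (v : ℕ)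

end HTSP

/-! ## A program logic for the machine

`WP B L p s Q`: started in a state whose entries are below `2 ^ B`, the program `p` halts in a state
satisfying `Q`, no entry ever reaches `2 ^ B`, and no loop makes more than `L` iterations. -/

namespace RAM

/-! The algorithm is greedy and never needs `M`, `α` or `β`. Trees are placed from the last class
down to the first, each on a vehicle for which (load + length of the tree) / speed is least. When a
tree of class `c` is placed, all trees placed so far, itself included, lie in classes `≥ c`, so the
second assignability condition bounds their total length by `β M` times the total speed of the
vehicles of level `≥ c - 1`. By averaging, one of these vehicles has load at most `β M` times its
speed. As `2 ^ c` is at most twice that speed, the first condition says that the new tree adds at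
most `2 α M` times the speed. The greedy choice finishes no later, so every load stays at most `(β +
2 α) M` times the speed (`exists_load_le`, `Greedy.load_le`).

A factor 2 turns loads into tours. Instead of an Euler tour, each tour is a duplicate-free list
starting at the depot, and along a tree edge `uv` with only `u` visited, `v` is inserted right after
`u`. By the triangle inequality this costs at most `2 d(u,v)`, and the edge is never charged again
(`walkLength_visit`). Sweeping `n` times over the edges reaches the whole tree (`mem_grow`). Hence
the makespan is at most `2 (β + 2 α) M`.

On the machine, distances are made integral by the product of all denominators, and tours are linked
lists. If `S` is the bit length of the input, every stored number has at most `3 S` bits and every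
loop makes at most `S` iterations (`budget`). The program is fixed, so these two bounds alone give
polynomial running time (`Prog.exists_polynomial_weight`). Correctness and both bounds are proved
together in a weakest-precondition calculus, ending in `wp_code`. -/

instance : Add Expr := ⟨.add⟩
instance : Sub Expr := ⟨.sub⟩
instance : Mul Expr := ⟨.mul⟩
instance : Div Expr := ⟨.div⟩
instance (c : ℕ) : OfNat Expr c := ⟨.lit c⟩

@[simp] theorem val_add (s : State) (e f : Expr) : (e + f).val s = e.val s + f.val s := rfl
@[simp] theorem val_sub (s : State) (e f : Expr) : (e - f).val s = e.val s - f.val s := rfl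
@[simp] theorem val_mul (s : State) (e f : Expr) : (e * f).val s = e.val s * f.val s := rfl
@[simp] theorem val_div (s : State) (e f : Expr) : (e / f).val s = e.val s / f.val s := rfl
@[simp] theorem val_ofNat (s : State) (c : ℕ) :
    (no_index (OfNat.ofNat c : Expr)).val s = OfNat.ofNat c := rfl
@[simp] theorem val_reg (s : State) (x : ℕ) : (Expr.reg x).val s = s.reg x := rfl
@[simp] theorem val_cell (s : State) (a : ℕ) (i : Expr) :
    (Expr.cell a i).val s = s.mem a (i.val s) := rfl

@[simp] theorem State.reg_setReg (s : State) (x v y : ℕ) :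
    (s.setReg x v).reg y = if y = x then v else s.reg y := by
  simp [State.setReg, Function.update_apply]

@[simp] theorem State.mem_setReg (s : State) (x v : ℕ) : (s.setReg x v).mem = s.mem := rfl

@[simp] theorem State.reg_setMem (s : State) (a i v : ℕ) : (s.setMem a i v).reg = s.reg := rfl

theorem State.mem_setMem (s : State) (a i v : ℕ) :
    (s.setMem a i v).mem a = Function.update (s.mem a) i v := by
  simp [State.setMem]

theorem State.mem_setMem_of_ne (s : State) {a b : ℕ} (i v : ℕ) (h : b ≠ a) :
    (s.setMem a i v).mem b = s.mem b := by
  simp [State.setMem, h]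

/-- All registers and cells hold numbers of at most `B` bits. -/
def State.Bounded (B : ℕ) (s : State) : Prop :=
  (∀ x, s.reg x < 2 ^ B) ∧ ∀ a i, s.mem a i < 2 ^ B

theorem State.Bounded.setReg {B : ℕ} {s : State} (h : s.Bounded B) (x : ℕ) {v : ℕ}
    (hv : v < 2 ^ B) : (s.setReg x v).Bounded B := by
  refine ⟨fun y => ?_, h.2⟩
  rw [State.reg_setReg]
  split_ifs
  · exact hv
  · exact h.1 y

theorem State.Bounded.setMem {B : ℕ} {s : State} (h : s.Bounded B) (a i : ℕ) {v : ℕ}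
    (hv : v < 2 ^ B) : (s.setMem a i v).Bounded B := by
  refine ⟨h.1, fun b j => ?_⟩
  rcases eq_or_ne b a with rfl | hb
  · rw [State.mem_setMem, Function.update_apply]
    split_ifs
    · exact hv
    · exact h.2 b j
  · rw [State.mem_setMem_of_ne _ _ _ hb]
    exact h.2 b j

/-- Evaluating `e` on numbers of at most `B` bits costs at most `e.weight * (B + 1)`. -/
def Expr.weight : Expr → ℕ
  | .lit c => 1 + Nat.size c
  | .reg _ => 1
  | .cell _ i => 1 + 2 * i.weight
  | .add e f => 1 + 2 * (e.weight + f.weight)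
  | .sub e f => 1 + 2 * (e.weight + f.weight)
  | .mul e f => 1 + 2 * (e.weight + f.weight)
  | .div e f => 1 + 2 * (e.weight + f.weight)

theorem size_add_le (a b : ℕ) : Nat.size (a + b) ≤ 1 + Nat.size a + Nat.size b := by
  rw [Nat.size_le]
  have ha := Nat.lt_size_self a
  have hb := Nat.lt_size_self b
  have h1 : 2 ^ Nat.size a ≤ 2 ^ (Nat.size a + Nat.size b) :=
    Nat.pow_le_pow_right (by simp) (by simp)
  have h2 : 2 ^ Nat.size b ≤ 2 ^ (Nat.size a + Nat.size b) :=
    Nat.pow_le_pow_right (by simp) (by simp)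
  rw [add_assoc, pow_add]
  omega

theorem size_mul_le (a b : ℕ) : Nat.size (a * b) ≤ Nat.size a + Nat.size b := by
  rw [Nat.size_le, pow_add]
  exact Nat.mul_lt_mul'' (Nat.lt_size_self a) (Nat.lt_size_self b)

/-- Costs charge the sizes of operands, so both bounds must go through one induction. Intermediate
values may exceed `2 ^ B`; only their size is controlled, which lets tests multiply loads by speeds.
-/
theorem Expr.size_val_le_and_cost_le {B : ℕ} {s : State} (hs : s.Bounded B) (e : Expr) :
    Nat.size (e.val s) ≤ e.weight * (B + 1) ∧ e.cost s ≤ e.weight * (B + 1) := by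
  have hreg : ∀ x, Nat.size (s.reg x) ≤ B := fun x => Nat.size_le.2 (hs.1 x)
  have hmem : ∀ a i, Nat.size (s.mem a i) ≤ B := fun a i => Nat.size_le.2 (hs.2 a i)
  induction e with
  | lit c => simp only [Expr.val, Expr.cost, Expr.weight]; constructor <;> nlinarith
  | reg x => have := hreg x; simp only [Expr.val, Expr.cost, Expr.weight]; constructor <;> nlinarith
  | cell a i ih =>
    obtain ⟨h1, h2⟩ := ih
    have := hmem a (i.val s)
    simp only [Expr.val, Expr.cost, Expr.weight]
    constructor <;> nlinarith
  | add e f he hf =>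
    obtain ⟨h1, h2⟩ := he
    obtain ⟨h3, h4⟩ := hf
    have := size_add_le (e.val s) (f.val s)
    simp only [Expr.val, Expr.cost, Expr.weight]
    constructor <;> nlinarith
  | sub e f he hf =>
    obtain ⟨h1, h2⟩ := he
    obtain ⟨h3, h4⟩ := hf
    have : Nat.size (e.val s - f.val s) ≤ Nat.size (e.val s) := Nat.size_le_size (Nat.sub_le _ _)
    simp only [Expr.val, Expr.cost, Expr.weight]
    constructor <;> nlinarith
  | mul e f he hf =>
    obtain ⟨h1, h2⟩ := he
    obtain ⟨h3, h4⟩ := hf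
    have := size_mul_le (e.val s) (f.val s)
    simp only [Expr.val, Expr.cost, Expr.weight]
    constructor <;> nlinarith
  | div e f he hf =>
    obtain ⟨h1, h2⟩ := he
    obtain ⟨h3, h4⟩ := hf
    have : Nat.size (e.val s / f.val s) ≤ Nat.size (e.val s) :=
      Nat.size_le_size (Nat.div_le_self _ _)
    simp only [Expr.val, Expr.cost, Expr.weight]
    constructor <;> nlinarith

/-- If every loop makes at most `L` iterations and all numbers have at most `B` bits, then running
`p` costs at most `p.weight L * (B + 1)`. -/
def Prog.weight (L : ℕ) : Prog → ℕ
  | .assign _ e => 1 + 2 * e.weight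
  | .store _ i e => 1 + 2 * i.weight + 2 * e.weight
  | .seq p q => p.weight L + q.weight L
  | .ite e p q => 1 + e.weight + p.weight L + q.weight L
  | .loop e p => (L + 1) * (1 + e.weight + p.weight L)

/-- Each loop contributes one factor `L + 1`, so the degree is at most the nesting depth of the
loops of `p`, which does not depend on the input. -/
theorem Prog.exists_polynomial_weight (p : Prog) :
    ∃ f : Polynomial ℕ, ∀ L, f.eval L = p.weight L := by
  induction p with
  | assign x e => exact ⟨.C (1 + 2 * e.weight), fun L => by simp [Prog.weight]⟩
  | store a i e => exact ⟨.C (1 + 2 * i.weight + 2 * e.weight), fun L => by simp [Prog.weight]⟩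
  | seq p q hp hq =>
    obtain ⟨f, hf⟩ := hp
    obtain ⟨g, hg⟩ := hq
    exact ⟨f + g, fun L => by simp [Prog.weight, hf, hg]⟩
  | ite e p q hp hq =>
    obtain ⟨f, hf⟩ := hp
    obtain ⟨g, hg⟩ := hq
    exact ⟨.C (1 + e.weight) + f + g, fun L => by simp [Prog.weight, hf, hg]⟩
  | loop e p hp =>
    obtain ⟨f, hf⟩ := hp
    exact ⟨(.X + 1) * (.C (1 + e.weight) + f), fun L => by simp [Prog.weight, hf]⟩

def WP (B L : ℕ) (p : Prog) (s : State) (Q : State → Prop) : Prop :=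
  s.Bounded B → ∃ s' t, Exec p s s' t ∧ t ≤ p.weight L * (B + 1) ∧ s'.Bounded B ∧ Q s'

variable {B L : ℕ} {s : State} {Q : State → Prop}

theorem WP.mono {p : Prog} {Q' : State → Prop} (h : WP B L p s Q) (hQ : ∀ s, Q s → Q' s) :
    WP B L p s Q' := by
  intro hs
  obtain ⟨s', t, h1, h2, h3, h4⟩ := h hs
  exact ⟨s', t, h1, h2, h3, hQ _ h4⟩

theorem WP.assign {x : ℕ} {e : Expr} (hv : s.Bounded B → e.val s < 2 ^ B)
    (hQ : Q (s.setReg x (e.val s))) : WP B L (.assign x e) s Q := by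
  intro hs
  obtain ⟨h1, h2⟩ := e.size_val_le_and_cost_le hs
  refine ⟨_, _, .assign x e s, ?_, hs.setReg x (hv hs), hQ⟩
  rw [Prog.weight]
  nlinarith

theorem WP.store {a : ℕ} {i e : Expr} (hv : s.Bounded B → e.val s < 2 ^ B)
    (hQ : Q (s.setMem a (i.val s) (e.val s))) : WP B L (.store a i e) s Q := by
  intro hs
  obtain ⟨h1, h2⟩ := e.size_val_le_and_cost_le hs
  obtain ⟨h3, h4⟩ := i.size_val_le_and_cost_le hs
  refine ⟨_, _, .store a i e s, ?_, hs.setMem a _ (hv hs), hQ⟩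
  rw [Prog.weight]
  nlinarith

/-- The continuation sits in the postcondition, so a program is verified by stepping through it
symbolically. -/
theorem WP.seq {p q : Prog} (h : WP B L p s fun s' => WP B L q s' Q) :
    WP B L (.seq p q) s Q := by
  intro hs
  obtain ⟨s₁, t₁, h1, h2, h3, h4⟩ := h hs
  obtain ⟨s₂, t₂, h5, h6, h7, h8⟩ := h4 h3
  refine ⟨s₂, _, .seq h1 h5, ?_, h7, h8⟩
  rw [Prog.weight]
  nlinarith

theorem WP.ite {e : Expr} {p q : Prog} (hp : e.val s ≠ 0 → WP B L p s Q)
    (hq : e.val s = 0 → WP B L q s Q) : WP B L (.ite e p q) s Q := by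
  intro hs
  obtain ⟨-, h0⟩ := e.size_val_le_and_cost_le hs
  by_cases h : e.val s = 0
  · obtain ⟨s', t, h1, h2, h3, h4⟩ := hq h hs
    refine ⟨s', _, .ite_false h h1, ?_, h3, h4⟩
    rw [Prog.weight]
    nlinarith [Nat.zero_le (p.weight L * (B + 1))]
  · obtain ⟨s', t, h1, h2, h3, h4⟩ := hp h hs
    refine ⟨s', _, .ite_true h h1, ?_, h3, h4⟩
    rw [Prog.weight]
    nlinarith [Nat.zero_le (q.weight L * (B + 1))]

/-- A loop that consumes a list. -/
theorem WP.loop_list {α : Type*} {e : Expr} {p : Prog} (J : List α → State → Prop) (l : List α)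
    (hl : l.length ≤ L) (h0 : J l s)
    (hstep : ∀ a l s, J (a :: l) s → e.val s ≠ 0 ∧ WP B L p s (J l))
    (hend : ∀ s, J [] s → e.val s = 0 ∧ Q s) : WP B L (.loop e p) s Q := by
  -- The cost is measured by the actual number of iterations so that induction on the list applies;
  -- `L` replaces it only at the end.
  suffices ∀ (l : List α) (s : State), J l s → s.Bounded B → ∃ s' t, Exec (.loop e p) s s' t ∧
      t ≤ (l.length + 1) * (1 + e.weight + p.weight L) * (B + 1) ∧ s'.Bounded B ∧ Q s' by
    intro hs
    obtain ⟨s', t, h1, h2, h3, h4⟩ := this l s h0 hs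
    refine ⟨s', t, h1, h2.trans ?_, h3, h4⟩
    rw [Prog.weight]
    gcongr
  intro l
  induction l with
  | nil =>
    intro s hJ hs
    obtain ⟨he, hQ⟩ := hend s hJ
    obtain ⟨-, h0⟩ := e.size_val_le_and_cost_le hs
    refine ⟨s, _, .loop_done he, ?_, hs, hQ⟩
    simp only [List.length_nil]
    nlinarith [Nat.zero_le (p.weight L * (B + 1))]
  | cons a l ih =>
    intro s hJ hs
    obtain ⟨he, hb⟩ := hstep a l s hJ
    obtain ⟨-, h0⟩ := e.size_val_le_and_cost_le hs
    obtain ⟨s₁, t₁, h1, h2, h3, h4⟩ := hb hs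
    obtain ⟨s₂, t₂, h5, h6, h7, h8⟩ := ih s₁ h4 h3
    refine ⟨s₂, _, .loop_step he h1 h5, ?_, h7, h8⟩
    simp only [List.length_cons]
    have : (l.length + 1 + 1) * (1 + e.weight + p.weight L) * (B + 1) =
      (l.length + 1) * (1 + e.weight + p.weight L) * (B + 1) +
        ((B + 1) + e.weight * (B + 1) + p.weight L * (B + 1)) := by ring
    rw [this]
    omega

/-- A loop that counts from `0` to `m`. -/
theorem WP.loop_count {e : Expr} {p : Prog} (J : ℕ → State → Prop) (m : ℕ) (hm : m ≤ L)
    (h0 : J 0 s) (hstep : ∀ i s, i < m → J i s → e.val s ≠ 0 ∧ WP B L p s (J (i + 1)))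
    (hend : ∀ s, J m s → e.val s = 0 ∧ Q s) : WP B L (.loop e p) s Q := by
  refine WP.loop_list (fun (l : List Unit) s => ∃ i, i + l.length = m ∧ J i s)
    (List.replicate m ()) (by simpa using hm) ⟨0, by simp, h0⟩ ?_ ?_
  · rintro a l s ⟨i, hi, hJ⟩
    simp only [List.length_cons] at hi
    obtain ⟨h1, h2⟩ := hstep i s (by omega) hJ
    exact ⟨h1, h2.mono fun s hs => ⟨i + 1, by omega, hs⟩⟩
  · rintro s ⟨i, hi, hJ⟩
    simp only [List.length_nil, Nat.add_zero] at hi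
    exact hend s (hi ▸ hJ)

/-! ### Emitting output -/

/-- Append the value of `e` to the output. -/
def emit (e : Expr) : Prog := .seq (.store 1 (.reg 0) e) (.assign 0 (.reg 0 + 1))

theorem output_emit (s : State) (v : ℕ) :
    output ((s.setMem 1 (s.reg 0) v).setReg 0 (s.reg 0 + 1)) = output s ++ [v] := by
  simp only [output, State.reg_setReg, if_true, List.range_succ, List.map_append, List.map_cons,
    List.map_nil, State.mem_setReg, State.mem_setMem, Function.update_self]
  congr 1
  refine List.map_congr_left fun i hi => ?_
  rw [Function.update_of_ne (List.mem_range.1 hi).ne]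

@[simp] theorem length_output (s : State) : (output s).length = s.reg 0 := by simp [output]

theorem WP.emit {e : Expr} (hv : s.Bounded B → e.val s < 2 ^ B) (h0 : s.reg 0 + 1 < 2 ^ B)
    (hQ : Q ((s.setMem 1 (s.reg 0) (e.val s)).setReg 0 (s.reg 0 + 1))) :
    WP B L (emit e) s Q :=
  .seq (.store hv (.assign (fun _ => h0) hQ))

/-! ### Reading a word -/

/-- From position `p` on, `f` lists the entries of `l`. -/
def Reads (f : ℕ → ℕ) (p : ℕ) (l : List ℕ) : Prop := ∀ i (h : i < l.length), f (p + i) = l[i]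

variable {f : ℕ → ℕ} {p : ℕ}

theorem reads_cons {a : ℕ} {l : List ℕ} : Reads f p (a :: l) ↔ f p = a ∧ Reads f (p + 1) l := by
  constructor
  · intro h
    refine ⟨h 0 (by simp), fun i hi => ?_⟩
    have := h (i + 1) (by simpa using hi)
    rw [add_right_comm, add_assoc]
    simpa using this
  · rintro ⟨h0, h⟩ i hi
    cases i with
    | zero => exact h0
    | succ i =>
      have := h i (by simpa using hi)
      rw [add_right_comm, add_assoc] at this
      simpa using this

theorem reads_append {l₁ l₂ : List ℕ} :
    Reads f p (l₁ ++ l₂) ↔ Reads f p l₁ ∧ Reads f (p + l₁.length) l₂ := by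
  induction l₁ generalizing p with
  | nil => simp [Reads]
  | cons a l ih =>
    rw [List.cons_append, reads_cons, reads_cons, ih, List.length_cons, and_assoc,
      add_assoc p 1, add_comm 1]

/-- Blocks of a common length `c` allow random access: block `i` starts at offset `c * i`. -/
theorem Reads.flatMap {α : Type*} {g : α → List ℕ} {c : ℕ} (hg : ∀ a, (g a).length = c)
    {l : List α} (h : Reads f p (l.flatMap g)) (i : ℕ) (hi : i < l.length) :
    Reads f (p + c * i) (g l[i]) := by
  induction l generalizing p i with
  | nil => simp at hi
  | cons a l ih =>
    rw [List.flatMap_cons, reads_append, hg] at h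
    cases i with
    | zero => simpa using h.1
    | succ i =>
      have := ih h.2 i (by simpa using hi)
      rw [mul_add, mul_one, add_comm (c * i), ← add_assoc]
      simpa using this

theorem reads_self (l : List ℕ) : Reads (fun i => l.getD i 0) 0 l := by
  intro i hi
  simp [hi]

/-! ### Bit lengths of words -/

theorem lt_two_pow_bitLength {l : List ℕ} {a : ℕ} (h : a ∈ l) : a < 2 ^ bitLength l := by
  rw [← Nat.size_le]
  have := List.le_sum_of_mem (List.mem_map_of_mem (f := fun a => Nat.size a + 1) h)
  exact (Nat.le_succ _).trans this

theorem length_le_bitLength (l : List ℕ) : l.length ≤ bitLength l := by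
  induction l with
  | nil => simp [bitLength]
  | cons a l ih => simp only [bitLength, List.map_cons, List.sum_cons, List.length_cons] at *; omega

theorem bitLength_le {l : List ℕ} (h : ∀ a ∈ l, a < 2 ^ B) : bitLength l ≤ l.length * (B + 1) := by
  induction l with
  | nil => simp [bitLength]
  | cons a l ih =>
    have h1 := ih fun a ha => h a (by simp [ha])
    have h2 : Nat.size a ≤ B := Nat.size_le.2 (h a (by simp))
    simp only [bitLength, List.map_cons, List.sum_cons, List.length_cons] at *
    nlinarith

theorem bounded_init {x : List ℕ} (h : bitLength x ≤ B) : (init x).Bounded B := by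
  have h2 : 2 ^ bitLength x ≤ 2 ^ B := Nat.pow_le_pow_right (by simp) h
  constructor
  · intro y
    simp only [init]
    split_ifs
    · exact ((length_le_bitLength x).trans_lt Nat.lt_two_pow_self).trans_le h2
    · positivity
  · intro a i
    simp only [init]
    split_ifs
    · rw [List.getD_eq_getElem?_getD]
      rcases lt_or_ge i x.length with hi | hi
      · rw [List.getElem?_eq_getElem hi]
        exact (lt_two_pow_bitLength (List.getElem_mem hi)).trans_le h2
      · rw [List.getElem?_eq_none hi]
        simp
    · positivity

end RAM

/-! ## Tours grown along trees -/

namespace HTSP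

variable (I : HTSP)

/-- Insert `v` after the first occurrence of `u`. -/
def insertAfter {α : Type*} [DecidableEq α] (u v : α) : List α → List α
  | [] => []
  | a :: l => if a = u then a :: v :: l else a :: insertAfter u v l

section insertAfter

variable {α : Type*} [DecidableEq α] {u v : α}

theorem insertAfter_perm {l : List α} (h : u ∈ l) : (insertAfter u v l).Perm (v :: l) := by
  induction l with
  | nil => simp at h
  | cons a l ih =>
    rw [insertAfter]
    split_ifs with ha
    · exact List.Perm.swap _ _ _
    · have hu : u ∈ l := by
        rcases List.mem_cons.1 h with h | h
        · exact absurd h.symm ha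
        · exact h
      exact ((ih hu).cons a).trans (List.Perm.swap _ _ _)

theorem head?_insertAfter (l : List α) : (insertAfter u v l).head? = l.head? := by
  cases l with
  | nil => rfl
  | cons a l => rw [insertAfter]; split_ifs <;> rfl

end insertAfter

/-- If the tour visits `u` but not `v`, insert `v` after `u`. -/
def visit (L : List (Fin I.n)) (u v : Fin I.n) : List (Fin I.n) :=
  if u ∈ L ∧ v ∉ L then insertAfter u v L else L

/-- Extend the tour along an edge. -/
def visitEdge (L : List (Fin I.n)) (e : Fin I.n × Fin I.n) : List (Fin I.n) :=
  I.visit (I.visit L e.1 e.2) e.2 e.1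

/-- Extend the tour along each edge of a list. -/
def sweep (T : I.EdgeList) (L : List (Fin I.n)) : List (Fin I.n) := T.foldl I.visitEdge L

/-- Extend the tour to the component of the depot. -/
def grow (T : I.EdgeList) (L : List (Fin I.n)) : List (Fin I.n) := (I.sweep T)^[I.n] L

/-- The tours under construction: no vertex occurs twice, and the first one is the depot. -/
def Simple (L : List (Fin I.n)) : Prop := L.Nodup ∧ L.head? = some I.r

variable {I}

theorem mem_visit {L : List (Fin I.n)} {u v a : Fin I.n} :
    a ∈ I.visit L u v ↔ a ∈ L ∨ (a = v ∧ u ∈ L) := by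
  rw [visit]
  split_ifs with h
  · rw [(insertAfter_perm h.1).mem_iff]
    simp [h.1, or_comm]
  · by_cases hu : u ∈ L
    · have : v ∈ L := by by_contra hv; exact h ⟨hu, hv⟩
      constructor
      · exact Or.inl
      · rintro (h | ⟨rfl, -⟩) <;> assumption
    · simp [hu]

theorem Simple.visit {L : List (Fin I.n)} (h : I.Simple L) (u v : Fin I.n) :
    I.Simple (I.visit L u v) := by
  rw [HTSP.visit]
  split_ifs with huv
  · refine ⟨?_, ?_⟩
    · rw [(insertAfter_perm huv.1).nodup_iff]
      exact List.nodup_cons.2 ⟨huv.2, h.1⟩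
    · rw [head?_insertAfter]; exact h.2
  · exact h

theorem Simple.visitEdge {L : List (Fin I.n)} (h : I.Simple L) (e : Fin I.n × Fin I.n) :
    I.Simple (I.visitEdge L e) := (h.visit _ _).visit _ _

theorem Simple.foldl {L : List (Fin I.n)} (h : I.Simple L) (T : I.EdgeList) :
    I.Simple (T.foldl I.visitEdge L) := by
  induction T generalizing L with
  | nil => exact h
  | cons e T ih => exact ih (h.visitEdge e)

theorem Simple.iterate {L : List (Fin I.n)} (h : I.Simple L) (T : I.EdgeList) (m : ℕ) :
    I.Simple ((I.sweep T)^[m] L) := by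
  induction m generalizing L with
  | zero => exact h
  | succ m ih => exact ih (h.foldl T)

theorem mem_visitEdge_of_mem {L : List (Fin I.n)} {e : Fin I.n × Fin I.n} {a : Fin I.n}
    (h : a ∈ L) : a ∈ I.visitEdge L e := mem_visit.2 (Or.inl (mem_visit.2 (Or.inl h)))

theorem mem_sweep_of_mem {T : I.EdgeList} {L : List (Fin I.n)} {a : Fin I.n}
    (h : a ∈ L) : a ∈ I.sweep T L := by
  unfold sweep
  induction T generalizing L with
  | nil => exact h
  | cons e T ih => exact ih (mem_visitEdge_of_mem h)

theorem mem_iterate_sweep_of_mem {T : I.EdgeList} {L : List (Fin I.n)} {a : Fin I.n}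
    (h : a ∈ L) (m : ℕ) : a ∈ (I.sweep T)^[m] L := by
  induction m generalizing L with
  | zero => exact h
  | succ m ih => exact ih (mem_sweep_of_mem h)

/-- Adjacency ignores the orientation in which the edge is listed; this is why `visitEdge` tries
both directions. -/
theorem mem_sweep {T : I.EdgeList} {L : List (Fin I.n)} {a b : Fin I.n}
    (hab : (I.graph T).Adj a b) (h : a ∈ L) : b ∈ I.sweep T L := by
  rw [graph, SimpleGraph.fromRel_adj] at hab
  replace hab := hab.2
  unfold sweep
  induction T generalizing L with
  | nil => simp at hab
  | cons e T ih =>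
    rw [List.foldl_cons]
    rcases hab with hab | hab
    · rcases List.mem_cons.1 hab with rfl | hab
      · exact mem_sweep_of_mem (mem_visit.2 (Or.inl (mem_visit.2 (Or.inr ⟨rfl, h⟩))))
      · exact ih (mem_visitEdge_of_mem h) (Or.inl hab)
    · rcases List.mem_cons.1 hab with rfl | hab
      · exact mem_sweep_of_mem (mem_visit.2 (Or.inr ⟨rfl, mem_visit.2 (Or.inl h)⟩))
      · exact ih (mem_visitEdge_of_mem h) (Or.inr hab)

theorem mem_iterate_sweep {T : I.EdgeList} {L : List (Fin I.n)} {a b : Fin I.n}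
    (p : (I.graph T).Walk a b) (h : a ∈ L) {m : ℕ} (hm : p.length ≤ m) :
    b ∈ (I.sweep T)^[m] L := by
  induction p generalizing L m with
  | nil => exact mem_iterate_sweep_of_mem h m
  | cons hab p ih =>
    rw [SimpleGraph.Walk.length_cons] at hm
    obtain ⟨m, rfl⟩ : ∃ m', m = m' + 1 := ⟨m - 1, by omega⟩
    exact ih (mem_sweep hab h) (by omega)

/-- Each sweep advances at least one edge along a path from the depot, and a path has fewer than `n`
edges. -/
theorem mem_grow {T : I.EdgeList} {L : List (Fin I.n)} (h : I.r ∈ L) {v : Fin I.n}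
    (hv : v ∈ I.treeVerts T) : v ∈ I.grow T L := by
  classical
  obtain ⟨p⟩ := hv
  refine mem_iterate_sweep p.toPath.1 h ?_
  have := p.toPath.2.length_lt
  rw [Fintype.card_fin] at this
  exact this.le

/-! ### The length of the grown tour -/

theorem walkLength_cons_cons (u v : Fin I.n) (l : List (Fin I.n)) :
    I.walkLength (u :: v :: l) = I.d u v + I.walkLength (v :: l) := by
  rw [walkLength]

/-- If `w` follows `u`, the triangle inequality bounds `d v w` by `d u v + d u w`, so the detour
costs at most `2 d u v`. The tail `t` leaves room for the final return to the depot. -/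
theorem walkLength_insertAfter {u : Fin I.n} (v : Fin I.n) {L : List (Fin I.n)}
    (h : u ∈ L) (t : List (Fin I.n)) :
    I.walkLength (insertAfter u v L ++ t) ≤ I.walkLength (L ++ t) + 2 * I.d u v := by
  induction L with
  | nil => simp at h
  | cons a L ih =>
    rw [insertAfter]
    split_ifs with ha
    · subst ha
      simp only [List.cons_append]
      rw [walkLength_cons_cons]
      have h0 := I.d_nonneg a v
      rcases L ++ t with - | ⟨w, l⟩
      · simp only [walkLength]; linarith
      · rw [walkLength_cons_cons, walkLength_cons_cons]
        have := I.d_triangle v a w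
        rw [I.d_symm v a] at this
        linarith
    · have hu : u ∈ L := by
        rcases List.mem_cons.1 h with h | h
        · exact absurd h.symm ha
        · exact h
      have ih := ih hu
      have hh := head?_insertAfter (u := u) (v := v) L
      cases L with
      | nil => simp at hu
      | cons b L =>
        -- The head `b` stays in place, so the step from `a` to `b` keeps its length.
        obtain ⟨l, hl⟩ : ∃ l, insertAfter u v (b :: L) = b :: l := by
          rw [insertAfter]; split_ifs <;> exact ⟨_, rfl⟩
        rw [hl] at ih ⊢
        simp only [List.cons_append] at ih ⊢
        rw [walkLength_cons_cons, walkLength_cons_cons]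
        linarith

/-- Total length of the edges that do not have both ends on the tour. -/
def pending (T : I.EdgeList) (L : List (Fin I.n)) : ℚ :=
  (T.map fun e => if e.1 ∈ L ∧ e.2 ∈ L then 0 else I.d e.1 e.2).sum

theorem sum_map_add_le {α : Type*} {f g : α → ℚ} {T : List α} (h : ∀ a ∈ T, f a ≤ g a)
    {e : α} (he : e ∈ T) : (T.map f).sum + (g e - f e) ≤ (T.map g).sum := by
  induction T with
  | nil => simp at he
  | cons a T ih =>
    simp only [List.map_cons, List.sum_cons]
    have ha := h a (by simp)
    have hT : ∀ a ∈ T, f a ≤ g a := fun a h' => h a (by simp [h'])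
    rcases List.mem_cons.1 he with rfl | he
    · linarith [List.sum_le_sum hT]
    · linarith [ih hT he]

theorem pending_anti (T : I.EdgeList) {L L' : List (Fin I.n)} (h : L ⊆ L') {e : Fin I.n × Fin I.n}
    (he : e ∈ T) (hL : ¬ (e.1 ∈ L ∧ e.2 ∈ L)) (hL' : e.1 ∈ L' ∧ e.2 ∈ L') :
    pending T L' + I.d e.1 e.2 ≤ pending T L := by
  have := sum_map_add_le (f := fun e => if e.1 ∈ L' ∧ e.2 ∈ L' then 0 else I.d e.1 e.2)
    (g := fun e => if e.1 ∈ L ∧ e.2 ∈ L then 0 else I.d e.1 e.2) (T := T) (fun a _ => ?_) he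
  · simpa [hL, hL', pending] using this
  · have := I.d_nonneg a.1 a.2
    split_ifs with h1 h2 h2
    · exact le_rfl
    · exact this
    · exact absurd ⟨h h2.1, h h2.2⟩ h1
    · exact le_rfl

/-- Potential argument: an insertion lengthens the closed walk by at most `2 d u v`, while the edge
`uv` stops being pending, since both its ends are now on the tour. -/
theorem walkLength_visit {T : I.EdgeList} (L : List (Fin I.n)) {u v : Fin I.n}
    (he : (u, v) ∈ T ∨ (v, u) ∈ T) :
    I.walkLength (I.visit L u v ++ [I.r]) + 2 * pending T (I.visit L u v) ≤
      I.walkLength (L ++ [I.r]) + 2 * pending T L := by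
  by_cases h : u ∈ L ∧ v ∉ L
  · have hsub : L ⊆ I.visit L u v := fun a ha => mem_visit.2 (Or.inl ha)
    have hu : u ∈ I.visit L u v := hsub h.1
    have hv : v ∈ I.visit L u v := mem_visit.2 (Or.inr ⟨rfl, h.1⟩)
    have h1 : I.walkLength (I.visit L u v ++ [I.r]) ≤ I.walkLength (L ++ [I.r]) + 2 * I.d u v := by
      rw [visit, if_pos h]
      exact walkLength_insertAfter v h.1 _
    have h2 : pending T (I.visit L u v) + I.d u v ≤ pending T L := by
      rcases he with he | he
      · exact pending_anti T hsub he (fun h' => h.2 h'.2) ⟨hu, hv⟩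
      · rw [I.d_symm u v]
        exact pending_anti T hsub he (fun h' => h.2 h'.1) ⟨hv, hu⟩
    linarith
  · rw [visit, if_neg h]

/-- The potential refers to the whole tree `T` while the induction consumes the list `T'`. -/
theorem walkLength_foldl {T T' : I.EdgeList} (hT : T' ⊆ T) (L : List (Fin I.n)) :
    I.walkLength (T'.foldl I.visitEdge L ++ [I.r]) + 2 * pending T (T'.foldl I.visitEdge L) ≤
      I.walkLength (L ++ [I.r]) + 2 * pending T L := by
  induction T' generalizing L with
  | nil => exact le_rfl
  | cons e T' ih =>
    have he : e ∈ T := hT (by simp)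
    refine (ih (fun a ha => hT (by simp [ha])) _).trans ?_
    exact (walkLength_visit _ (Or.inr he)).trans (walkLength_visit _ (Or.inl he))

theorem pending_nonneg (T : I.EdgeList) (L : List (Fin I.n)) : 0 ≤ pending T L := by
  refine List.sum_nonneg fun x hx => ?_
  obtain ⟨e, -, rfl⟩ := List.mem_map.1 hx
  split_ifs
  · exact le_rfl
  · exact I.d_nonneg _ _

theorem pending_le (T : I.EdgeList) (L : List (Fin I.n)) : pending T L ≤ I.edgeLength T := by
  refine List.sum_le_sum fun e _ => ?_
  split_ifs
  · exact I.d_nonneg _ _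
  · exact le_rfl

/-- The pending length is at most `d(T)` at the start and nonnegative at the end, and the potential
never rises. -/
theorem walkLength_grow (T : I.EdgeList) (L : List (Fin I.n)) :
    I.walkLength (I.grow T L ++ [I.r]) ≤ I.walkLength (L ++ [I.r]) + 2 * I.edgeLength T := by
  have key : ∀ m L, I.walkLength ((I.sweep T)^[m] L ++ [I.r]) + 2 * pending T ((I.sweep T)^[m] L) ≤
      I.walkLength (L ++ [I.r]) + 2 * pending T L := by
    intro m
    induction m with
    | zero => intro L; exact le_rfl
    | succ m ih => intro L; exact (ih _).trans (walkLength_foldl (fun _ h => h) L)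
  have := key I.n L
  have h1 := pending_le T L
  have h2 := pending_nonneg T ((I.sweep T)^[I.n] L)
  rw [grow]
  linarith

/-! ## Greedy assignment of the trees -/

variable (I)

/-- All distances, row by row. -/
def dists : List ℚ := (List.finRange I.n).flatMap fun u => (List.finRange I.n).map (I.d u)

/-- A common denominator of the distances. -/
def denom : ℕ := (I.dists.map Rat.den).prod

/-- Distances multiplied by the common denominator. -/
def scaled (u v : Fin I.n) : ℕ := (I.d u v).num.natAbs * (I.denom / (I.d u v).den)

/-- Total scaled length of a set of edges. -/
def scaledLength (T : I.EdgeList) : ℕ := (T.map fun e => I.scaled e.1 e.2).sum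

variable {I}

theorem mem_dists (u v : Fin I.n) : I.d u v ∈ I.dists := by
  simp only [dists, List.mem_flatMap, List.mem_map]
  exact ⟨u, by simp, v, by simp, rfl⟩

theorem denom_pos : 0 < I.denom := by
  refine List.prod_pos fun a ha => ?_
  obtain ⟨q, -, rfl⟩ := List.mem_map.1 ha
  exact q.den_pos

/-- Each denominator divides the product of all of them, so the floor division in `scaled` is exact.
-/
theorem scaled_eq (u v : Fin I.n) : (I.scaled u v : ℚ) = I.denom * I.d u v := by
  have hdvd : (I.d u v).den ∣ I.denom := List.dvd_prod (List.mem_map_of_mem (mem_dists u v))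
  have hden : ((I.d u v).den : ℚ) ≠ 0 := by exact_mod_cast (I.d u v).den_nz
  rw [scaled, Nat.cast_mul, Nat.cast_div hdvd hden, Nat.cast_natAbs,
    abs_of_nonneg (Rat.num_nonneg.2 (I.d_nonneg u v))]
  rw [← Rat.mul_den_eq_num (I.d u v)]
  field_simp

theorem scaledLength_eq (T : I.EdgeList) : (I.scaledLength T : ℚ) = I.denom * I.edgeLength T := by
  induction T with
  | nil => simp [scaledLength, edgeLength]
  | cons e T ih =>
    simp only [scaledLength, edgeLength, List.map_cons, List.sum_cons, Nat.cast_add] at *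
    rw [ih, scaled_eq]
    ring

/-- Vehicle `b` finishes earliest when it is given an additional load `len`. -/
def IsBest (load : Fin I.k → ℕ) (len : ℕ) (b : Fin I.k) : Prop :=
  ∀ i, (load b + len) * I.speed i ≤ (load i + len) * I.speed b

/-- The outcomes of assigning the trees of a list, last one first, each to a vehicle that finishes
earliest: the (scaled) load and the tour of each vehicle. -/
inductive Greedy : List I.EdgeList → (Fin I.k → ℕ) → (Fin I.k → List (Fin I.n)) → Prop
  | nil : Greedy [] (fun _ => 0) (fun _ => [I.r])
  | cons {l : List I.EdgeList} {load : Fin I.k → ℕ} {tour : Fin I.k → List (Fin I.n)}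
      (T : I.EdgeList) (b : Fin I.k) : Greedy l load tour → IsBest load (I.scaledLength T) b →
      Greedy (T :: l) (Function.update load b (load b + I.scaledLength T))
        (Function.update tour b (I.grow T (tour b)))

variable {l : List I.EdgeList} {load : Fin I.k → ℕ} {tour : Fin I.k → List (Fin I.n)}

theorem Greedy.simple (h : Greedy l load tour) (i : Fin I.k) : I.Simple (tour i) := by
  induction h generalizing i with
  | nil => simp [Simple]
  | cons T b _ _ ih =>
    rw [Function.update_apply]
    split_ifs
    · exact Simple.iterate (ih b) T _
    · exact ih i

theorem Simple.depot_mem {L : List (Fin I.n)} (h : I.Simple L) : I.r ∈ L :=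
  List.mem_of_head? h.2

theorem Greedy.covers (h : Greedy l load tour) {T : I.EdgeList} (hT : T ∈ l) {v : Fin I.n}
    (hv : v ∈ I.treeVerts T) : ∃ i, v ∈ tour i := by
  induction h with
  | nil => simp at hT
  | @cons l load tour T' b h _ ih =>
    rcases List.mem_cons.1 hT with rfl | hT
    · exact ⟨b, by simpa using mem_grow (h.simple b).depot_mem hv⟩
    · obtain ⟨i, hi⟩ := ih hT
      refine ⟨i, ?_⟩
      rw [Function.update_apply]
      split_ifs with hib
      · subst hib
        exact mem_iterate_sweep_of_mem hi _
      · exact hi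

theorem Greedy.walkLength_le (h : Greedy l load tour) (i : Fin I.k) :
    I.denom * I.walkLength (tour i ++ [I.r]) ≤ 2 * load i := by
  induction h with
  | nil => simp [walkLength, I.d_self]
  | @cons l load tour T b _ _ ih =>
    rcases eq_or_ne i b with rfl | hib
    · rw [Function.update_self, Function.update_self]
      have h1 := walkLength_grow T (tour i)
      have h2 : (0 : ℚ) < I.denom := by exact_mod_cast denom_pos
      push_cast
      rw [scaledLength_eq]
      nlinarith [mul_le_mul_of_nonneg_left h1 h2.le, ih]
    · rw [Function.update_of_ne hib, Function.update_of_ne hib]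
      exact ih

/-- Serves twice: for the averaging argument, and to show that no load overflows. -/
theorem Greedy.sum_load (h : Greedy l load tour) :
    ∑ i, load i = (l.map I.scaledLength).sum := by
  induction h with
  | nil => simp
  | @cons l load tour T b _ _ ih =>
    rw [List.map_cons, List.sum_cons, ← ih, Finset.sum_update_of_mem (Finset.mem_univ b),
      ← Finset.add_sum_erase _ load (Finset.mem_univ b), Finset.erase_eq]
    ring

/-! ### The greedy bound -/

/-- Regrouping by vehicles instead of levels prepares the averaging over vehicles. -/
theorem sum_speed (c : ℕ) :
    ∑ j ∈ Finset.Icc c I.maxLvl, (2 : ℝ) ^ j * (I.mu j : ℝ) =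
      ∑ i with c ≤ I.lvl i, (I.speed i : ℝ) := by
  rw [← Finset.sum_fiberwise_of_maps_to (s := Finset.univ.filter fun i => c ≤ I.lvl i)
    (t := Finset.Icc c I.maxLvl) (g := I.lvl)]
  · refine Finset.sum_congr rfl fun j hj => ?_
    rw [Finset.mem_Icc] at hj
    rw [Finset.filter_filter, mu]
    have : (Finset.univ.filter fun i => c ≤ I.lvl i ∧ I.lvl i = j) =
        Finset.univ.filter fun i => I.lvl i = j := by
      ext i; simp only [Finset.mem_filter]; constructor
      · tauto
      · rintro ⟨h, rfl⟩; exact ⟨h, hj.1, rfl⟩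
    rw [this, Finset.sum_congr rfl (g := fun _ => (2 : ℝ) ^ j)]
    · simp [mul_comm]
    · intro i hi
      rw [Finset.mem_filter] at hi
      simp [speed, hi.2]
  · intro i hi
    rw [Finset.mem_filter] at hi
    exact Finset.mem_Icc.2 ⟨hi.2, Finset.le_sup (Finset.mem_univ i)⟩

theorem sum_classLength (C : I.Collection) (c : ℕ) :
    ∑ j ∈ Finset.Ico c C.length, I.classLength C j =
      ((C.drop c).flatten.map I.edgeLength).sum := by
  induction C generalizing c with
  | nil => simp
  | cons 𝒯 C ih =>
    have hsucc : ∀ c, ∑ j ∈ Finset.Ico (c + 1) (C.length + 1), I.classLength (𝒯 :: C) j =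
        ((C.drop c).flatten.map I.edgeLength).sum := by
      intro c
      rw [← ih, ← Finset.sum_Ico_add']
      rfl
    cases c with
    | zero =>
      rw [List.length_cons, Finset.sum_eq_sum_Ico_succ_bot (by simp), hsucc]
      simp [classLength]
    | succ c => exact hsucc c

/-- This is what the order "last tree first" gains: whatever is placed before `T` belongs to the
class of `T` or a later one. -/
theorem exists_class {C : I.Collection} {l₁ l₂ : List I.EdgeList} {T : I.EdgeList}
    (h : C.flatten = l₁ ++ T :: l₂) :
    ∃ c, T ∈ C.getD c [] ∧ (T :: l₂) <:+ (C.drop c).flatten := by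
  induction C generalizing l₁ with
  | nil => simp at h
  | cons 𝒯 C ih =>
    rw [List.flatten_cons] at h
    rcases List.append_eq_append_iff.1 h with ⟨l, rfl, hl⟩ | ⟨l, rfl, hl⟩
    · obtain ⟨c, h1, h2⟩ := ih hl
      exact ⟨c + 1, by simpa using h1, by simpa using h2⟩
    · rcases l with - | ⟨T', l⟩
      -- Here `l₁` is exactly the first class, so `T` is the first tree of the later classes.
      · obtain ⟨c, h1, h2⟩ := ih (l₁ := []) (by simpa using hl.symm)
        exact ⟨c + 1, by simpa using h1, by simpa using h2⟩
      · refine ⟨0, ?_, ?_⟩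
        · rw [List.cons_append, List.cons.injEq] at hl
          simp [hl.1]
        · rw [List.drop_zero, List.flatten_cons, List.append_assoc, ← hl]
          exact List.suffix_append _ _

theorem edgeLength_nonneg (T : I.EdgeList) : 0 ≤ I.edgeLength T := by
  refine List.sum_nonneg fun x hx => ?_
  obtain ⟨e, -, rfl⟩ := List.mem_map.1 hx
  exact I.d_nonneg _ _

theorem speed_pos (i : Fin I.k) : 0 < I.speed i := by simp [speed]

/-- The averaging step: some vehicle could take a further tree of length `d` from class `c` and
still respect the bound. `D` is the scaling factor of the loads. -/
theorem exists_load_le {M α β D d : ℝ} (hM : 0 ≤ M) (hα : 0 ≤ α) (hβ : 0 ≤ β) (hD : 0 ≤ D)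
    (hd : 0 ≤ d) {c : ℕ} (load : Fin I.k → ℕ) (hdα : d ≤ α * 2 ^ c * M)
    (hsum : (∑ i, load i : ℝ) + D * d ≤ D * (β * M * ∑ i with c - 1 ≤ I.lvl i, (I.speed i : ℝ))) :
    ∃ i, (load i : ℝ) + D * d ≤ D * ((β + 2 * α) * M) * I.speed i := by
  have hload : ∀ i, (0 : ℝ) ≤ load i := fun i => Nat.cast_nonneg _
  have hDd : 0 ≤ D * d := mul_nonneg hD hd
  rcases (Finset.univ.filter fun i => c - 1 ≤ I.lvl i).eq_empty_or_nonempty with he | hne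
  -- No vehicle is fast enough, so the total length is at most `0` and any vehicle will do.
  · rw [he, Finset.sum_empty, mul_zero, mul_zero] at hsum
    let i : Fin I.k := ⟨0, I.k_pos⟩
    refine ⟨i, ?_⟩
    have h1 : (load i : ℝ) ≤ ∑ i, (load i : ℝ) :=
      Finset.single_le_sum (fun i _ => hload i) (Finset.mem_univ i)
    have : 0 ≤ D * ((β + 2 * α) * M) * I.speed i := by positivity
    linarith
  · have h1 : ∑ i with c - 1 ≤ I.lvl i, (load i : ℝ) ≤
        ∑ i with c - 1 ≤ I.lvl i, D * (β * M) * (I.speed i : ℝ) := by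
      rw [← Finset.mul_sum]
      have : ∑ i with c - 1 ≤ I.lvl i, (load i : ℝ) ≤ ∑ i, (load i : ℝ) :=
        Finset.sum_le_sum_of_subset_of_nonneg (Finset.filter_subset _ _) fun i _ _ => hload i
      linarith
    obtain ⟨i, hi, hle⟩ := Finset.exists_le_of_sum_le hne h1
    refine ⟨i, ?_⟩
    -- The level is at least `c - 1`; this loss of a factor 2 is the source of `2 * α`.
    have hc : (2 : ℝ) ^ c ≤ 2 * I.speed i := by
      rw [Finset.mem_filter] at hi
      have : (2 : ℝ) ^ c ≤ 2 ^ (I.lvl i + 1) := pow_le_pow_right₀ (by norm_num) (by omega)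
      rw [pow_succ] at this
      rw [speed]; push_cast; linarith
    have h2 : D * d ≤ D * (α * (2 * I.speed i) * M) := by
      refine mul_le_mul_of_nonneg_left (hdα.trans ?_) hD
      gcongr
    linarith

/-- Induction over the placed trees, which form a suffix of the flattened collection. Only the
vehicle receiving `T` changes; it finishes no later than the vehicle supplied by `exists_load_le`
would. -/
theorem Greedy.load_le {M α β : ℝ} {C : I.Collection} (hM : 0 ≤ M) (hα : 0 ≤ α) (hβ : 0 ≤ β)
    (hC : I.Assignable M α β C) (h : Greedy l load tour) (hl : l <:+ C.flatten) (i : Fin I.k) :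
    (load i : ℝ) ≤ I.denom * ((β + 2 * α) * M) * I.speed i := by
  induction h generalizing i with
  | nil => simp only [Nat.cast_zero]; positivity
  | @cons l load tour T b hg hb ih =>
    have hl' : l <:+ C.flatten := (List.suffix_cons T l).trans hl
    rw [Function.update_apply]
    split_ifs with hib
    · subst hib
      obtain ⟨l₁, hl₁⟩ := hl
      obtain ⟨c, hTc, hsuf⟩ := exists_class hl₁.symm
      have hsum := hC.2.2.2 c
      rw [sum_speed, ← Rat.cast_sum, sum_classLength] at hsum
      -- `T` and the trees placed before it are among those of classes `≥ c`; the remaining lengths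
      -- are nonnegative.
      have hle : ((T :: l).map I.edgeLength).sum ≤ ((C.drop c).flatten.map I.edgeLength).sum := by
        obtain ⟨l₂, hl₂⟩ := hsuf
        rw [← hl₂, List.map_append, List.sum_append]
        have : 0 ≤ (l₂.map I.edgeLength).sum := by
          refine List.sum_nonneg fun x hx => ?_
          obtain ⟨e, -, rfl⟩ := List.mem_map.1 hx
          exact edgeLength_nonneg _
        linarith
      have hD : (0 : ℝ) ≤ I.denom := Nat.cast_nonneg _
      have hlen : (I.scaledLength T : ℝ) = I.denom * (I.edgeLength T : ℝ) := by
        exact_mod_cast congrArg (Rat.cast : ℚ → ℝ) (scaledLength_eq T)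
      have hloads : ((∑ j, load j : ℕ) : ℝ) = I.denom * ((l.map I.edgeLength).sum : ℝ) := by
        rw [hg.sum_load]
        clear * -
        induction l with
        | nil => simp
        | cons T l ih =>
          have := congrArg (Rat.cast : ℚ → ℝ) (scaledLength_eq T)
          push_cast at this
          simp only [List.map_cons, List.sum_cons, Nat.cast_add, Rat.cast_add, ih, this]
          ring
      obtain ⟨j, hj⟩ := exists_load_le (D := I.denom) (d := I.edgeLength T) hM hα hβ hD
        (by exact_mod_cast edgeLength_nonneg T) load (hC.2.2.1 c T hTc) (by
          rw [← Nat.cast_sum, hloads, ← mul_add]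
          refine mul_le_mul_of_nonneg_left ?_ hD
          refine le_trans ?_ hsum
          rw [List.map_cons, List.sum_cons] at hle
          have : ((I.edgeLength T + (l.map I.edgeLength).sum : ℚ) : ℝ) ≤ _ := Rat.cast_le.2 hle
          push_cast at this ⊢
          linarith)
      rw [← hlen] at hj
      have hbj : ((load i : ℝ) + I.scaledLength T) * I.speed j ≤
          (load j + I.scaledLength T) * I.speed i := by exact_mod_cast hb j
      have hsj : (0 : ℝ) < I.speed j := by exact_mod_cast speed_pos j
      have hsi : (0 : ℝ) < I.speed i := by exact_mod_cast speed_pos i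
      push_cast
      refine le_of_mul_le_mul_right ?_ hsj
      calc _ ≤ _ := hbj
        _ ≤ (I.denom * ((β + 2 * α) * M) * I.speed j) * I.speed i := by gcongr
        _ = _ := by ring
    · exact ih hl' i

/-! ### The solution -/

variable (I) in
/-- The tour of `n + 1` vertices that follows `L` and then stays at the depot. -/
def closeTour (L : List (Fin I.n)) : List (Fin I.n) :=
  L ++ List.replicate (I.n + 1 - L.length) I.r

theorem Simple.length_le {L : List (Fin I.n)} (h : I.Simple L) : L.length ≤ I.n := by
  simpa using h.1.length_le_card

theorem length_closeTour {L : List (Fin I.n)} (h : I.Simple L) :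
    (I.closeTour L).length = I.n + 1 := by
  have := h.length_le
  simp only [closeTour, List.length_append, List.length_replicate]
  omega

theorem walkLength_append_replicate (L : List (Fin I.n)) (m : ℕ) :
    I.walkLength (L ++ List.replicate (m + 1) I.r) = I.walkLength (L ++ [I.r]) := by
  induction L with
  | nil =>
    induction m with
    | zero => rfl
    | succ m ih =>
      rw [← ih]
      simp only [List.replicate_succ, List.nil_append]
      rw [walkLength_cons_cons, I.d_self, zero_add]
  | cons a L ih =>
    cases L with
    | nil =>
      simp only [List.cons_append, List.nil_append, List.replicate_succ] at ih ⊢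
      rw [walkLength_cons_cons, walkLength_cons_cons, ih]
    | cons b L =>
      simp only [List.cons_append] at ih ⊢
      rw [walkLength_cons_cons, walkLength_cons_cons, ih]

theorem Simple.closeTour_eq {L : List (Fin I.n)} (h : I.Simple L) :
    ∃ m, I.closeTour L = L ++ List.replicate (m + 1) I.r := by
  refine ⟨I.n - L.length, ?_⟩
  rw [closeTour, Nat.sub_add_comm h.length_le]

theorem Simple.isTour_closeTour {L : List (Fin I.n)} (h : I.Simple L) :
    I.IsTour (I.closeTour L) := by
  obtain ⟨m, hm⟩ := h.closeTour_eq
  rw [hm]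
  constructor
  · rw [List.head?_append, h.2]; rfl
  · rw [List.getLast?_append, List.getLast?_replicate]; simp

theorem Simple.walkLength_closeTour {L : List (Fin I.n)} (h : I.Simple L) :
    I.walkLength (I.closeTour L) = I.walkLength (L ++ [I.r]) := by
  obtain ⟨m, hm⟩ := h.closeTour_eq
  rw [hm, walkLength_append_replicate]

theorem Greedy.isSolution {M α β : ℝ} {C : I.Collection} (hC : I.Assignable M α β C)
    (h : Greedy C.flatten load tour) : I.IsSolution fun i => I.closeTour (tour i) := by
  refine ⟨fun i => (h.simple i).isTour_closeTour, fun v => ?_⟩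
  obtain ⟨𝒯, h𝒯, T, hT, hv⟩ := hC.2.1 v
  obtain ⟨i, hi⟩ := h.covers (List.mem_flatten.2 ⟨𝒯, h𝒯, hT⟩) hv
  exact ⟨i, List.mem_append_left _ hi⟩

/-- The factor 2 between tour length and load turns `β + 2 * α` into `4 * α + 2 * β`; the common
denominator cancels. -/
theorem Greedy.makespan_le {M α β : ℝ} {C : I.Collection} (hM : 0 ≤ M) (hα : 0 ≤ α) (hβ : 0 ≤ β)
    (hC : I.Assignable M α β C) (h : Greedy C.flatten load tour) :
    I.makespan (fun i => I.closeTour (tour i)) ≤ (4 * α + 2 * β) * M := by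
  have : Nonempty (Fin I.k) := ⟨⟨0, I.k_pos⟩⟩
  refine ciSup_le fun i => ?_
  have hs : (0 : ℝ) < I.speed i := by exact_mod_cast speed_pos i
  have hD : (0 : ℝ) < I.denom := by exact_mod_cast denom_pos (I := I)
  rw [(h.simple i).walkLength_closeTour, div_le_iff₀ hs]
  have h1 := h.load_le hM hα hβ hC (List.suffix_refl _) i
  have h2 : (I.denom : ℝ) * (I.walkLength (tour i ++ [I.r]) : ℝ) ≤ 2 * load i := by
    exact_mod_cast h.walkLength_le i
  refine le_of_mul_le_mul_left ?_ hD
  linarith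

end HTSP

/-! ## The input word -/

namespace HTSP

open RAM

variable (I : HTSP)

/-- The entry of the input word at a position. -/
def input (C : I.Collection) (i : ℕ) : ℕ := (I.encodeInput C).getD i 0

/-- Numerator and denominator of a distance. -/
def encodeRat (q : ℚ) : List ℕ := [q.num.natAbs, q.den]

/-- The end points of an edge. -/
def ends (e : Fin I.n × Fin I.n) : List ℕ := [(e.1 : ℕ), (e.2 : ℕ)]

/-- Encoding of a class. -/
def encodeClass (𝒯 : List I.EdgeList) : List ℕ := 𝒯.length :: 𝒯.flatMap I.encodeTree

/-- Position of the depot in the input word. -/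
def depotPos : ℕ := 1 + 2 * (I.n * I.n)

theorem encodeTree_eq (T : I.EdgeList) : I.encodeTree T = T.length :: T.flatMap I.ends := rfl

theorem length_flatMap_encodeRat (l : List ℚ) : (l.flatMap encodeRat).length = 2 * l.length := by
  induction l with
  | nil => rfl
  | cons q l ih =>
    rw [List.flatMap_cons, List.length_append, ih, encodeRat]
    simp only [List.length_cons, List.length_nil]
    omega

theorem length_flatMap_ends (l : I.EdgeList) : (l.flatMap I.ends).length = 2 * l.length := by
  induction l with
  | nil => rfl
  | cons q l ih =>
    rw [List.flatMap_cons, List.length_append, ih, ends]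
    simp only [List.length_cons, List.length_nil]
    omega

theorem length_dists : I.dists.length = I.n * I.n := by
  simp [dists, List.length_flatMap]

theorem encodeInput_eq (C : I.Collection) : I.encodeInput C =
    I.n :: (I.dists.flatMap encodeRat ++ ((I.r : ℕ) :: I.k :: ((List.finRange I.k).map I.speed ++
      C.length :: C.flatMap I.encodeClass))) := by
  have h : (List.finRange I.n).flatMap (fun u => (List.finRange I.n).flatMap fun v =>
      [(I.d u v).num.natAbs, (I.d u v).den]) = I.dists.flatMap encodeRat := by
    simp only [dists, List.flatMap_assoc, List.flatMap_map]
    rfl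
  simp only [encodeInput, encode, h, encodeCollection, List.append_assoc, List.cons_append,
    List.nil_append]
  rfl

variable {I} {C : I.Collection}

theorem input_spec : I.input C 0 = I.n ∧ Reads (I.input C) 1 (I.dists.flatMap encodeRat) ∧
    I.input C I.depotPos = I.r ∧ I.input C (I.depotPos + 1) = I.k ∧
    Reads (I.input C) (I.depotPos + 2) ((List.finRange I.k).map I.speed) ∧
    I.input C (I.depotPos + 2 + I.k) = C.length ∧
    Reads (I.input C) (I.depotPos + 2 + I.k + 1) (C.flatMap I.encodeClass) := by
  have h := reads_self (I.encodeInput C)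
  rw [encodeInput_eq] at h
  rw [reads_cons, reads_append, reads_cons, reads_cons, reads_append, reads_cons,
    length_flatMap_encodeRat, length_dists, ← encodeInput_eq] at h
  simp only [zero_add, List.length_map, List.length_finRange] at h
  exact h

theorem length_encodeInput : (I.encodeInput C).length =
    I.depotPos + 2 + I.k + 1 + (C.flatMap I.encodeClass).length := by
  rw [encodeInput_eq]
  simp only [List.length_cons, List.length_append, length_flatMap_encodeRat, length_dists,
    List.length_map, List.length_finRange, depotPos]
  omega

theorem input_speed (i : Fin I.k) : I.input C (I.depotPos + 2 + i) = I.speed i := by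
  have := (input_spec (C := C)).2.2.2.2.1 i (by simp)
  simpa using this

/-- A row of the matrix takes `2 * n` entries and a rational takes two, after the leading entry `n`.
-/
theorem input_dist (u v : Fin I.n) :
    I.input C (1 + 2 * (u * I.n + v)) = (I.d u v).num.natAbs ∧
      I.input C (2 + 2 * (u * I.n + v)) = (I.d u v).den := by
  have h := (input_spec (C := C)).2.1
  rw [dists, List.flatMap_assoc] at h
  have h1 := h.flatMap (c := 2 * I.n) (fun a => by
    rw [length_flatMap_encodeRat]; simp) u (by simp)
  have h2 := h1.flatMap (c := 2) (fun a => rfl) v (by simp)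
  simp only [List.getElem_finRange, List.getElem_map, Fin.cast_mk, Fin.eta, encodeRat,
    reads_cons] at h2
  have e : 1 + 2 * I.n * u + 2 * v = 1 + 2 * (u * I.n + v) := by ring
  rw [e] at h2
  refine ⟨h2.1, ?_⟩
  rw [← h2.2.1]
  congr 1
  omega

theorem length_le_length_flatMap {α β : Type*} {g : α → List β} (hg : ∀ a, 1 ≤ (g a).length)
    (l : List α) : l.length ≤ (l.flatMap g).length := by
  induction l with
  | nil => simp
  | cons a l ih =>
    have := hg a
    simp only [List.flatMap_cons, List.length_append, List.length_cons]
    omega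

/-! ## The program -/

section Program

/-! Registers: number of vertices, depot, number of vehicles, common denominator, position of the
speeds; number of trees left, position and number of edges of the current tree, its length;
best vehicle; counters; current edge. -/

@[simp] def xN : ℕ := 1
@[simp] def xR : ℕ := 2
@[simp] def xK : ℕ := 3
@[simp] def xD : ℕ := 4
@[simp] def xS : ℕ := 5
@[simp] def xC : ℕ := 6
@[simp] def xP : ℕ := 7
@[simp] def xM : ℕ := 8
@[simp] def xL : ℕ := 9
@[simp] def xB : ℕ := 10
@[simp] def xH : ℕ := 11
@[simp] def xI : ℕ := 12
@[simp] def xQ : ℕ := 13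
@[simp] def xJ : ℕ := 14
@[simp] def xU : ℕ := 15
@[simp] def xV : ℕ := 16

local infixr:30 " ;; " => Prog.seq
local infix:40 " ::= " => Prog.assign
local prefix:max "♯" => Expr.reg

def skip : Prog := 0 ::= ♯0

/-- Bank `2` lists the positions of the trees, bank `3` the loads; in bank `4` the cell
`i * n + u` is `0` if vehicle `i` does not visit `u`, otherwise the successor of `u` plus one. -/
def next (i u : ℕ) : Expr := Expr.cell 4 (♯i * ♯xN + ♯u)

def denomCode : Prog :=
  xN ::= Expr.cell 0 0 ;; xD ::= 1 ;; xP ::= 1 ;; xI ::= ♯xN * ♯xN ;;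
  .loop ♯xI (xD ::= ♯xD * Expr.cell 0 (♯xP + 1) ;; xP ::= ♯xP + 2 ;; xI ::= ♯xI - 1)

def headerCode : Prog :=
  xR ::= Expr.cell 0 ♯xP ;; xK ::= Expr.cell 0 (♯xP + 1) ;; xS ::= ♯xP + 2 ;; xP ::= ♯xS + ♯xK

def initToursCode : Prog :=
  xI ::= 0 ;; .loop (♯xK - ♯xI) (.store 4 (♯xI * ♯xN + ♯xR) (♯xR + 1) ;; xI ::= ♯xI + 1)

/-- Trees have encodings of different lengths, so their positions are recorded in one pass. Popping
this stack yields the last tree first, as the greedy bound requires. -/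
def parseCode : Prog :=
  xC ::= 0 ;; xI ::= Expr.cell 0 ♯xP ;; xP ::= ♯xP + 1 ;;
  .loop ♯xI (xJ ::= Expr.cell 0 ♯xP ;; xP ::= ♯xP + 1 ;; xI ::= ♯xI - 1 ;;
    .loop ♯xJ (.store 2 ♯xC ♯xP ;; xC ::= ♯xC + 1 ;; xP ::= ♯xP + 1 + 2 * Expr.cell 0 ♯xP ;;
      xJ ::= ♯xJ - 1))

/-- Run `body` for every edge of the current tree. -/
def edgeLoop (body : Prog) : Prog :=
  xQ ::= ♯xP ;; xJ ::= ♯xM ;;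
  .loop ♯xJ (xU ::= Expr.cell 0 ♯xQ ;; xV ::= Expr.cell 0 (♯xQ + 1) ;; xQ ::= ♯xQ + 2 ;; xJ ::= ♯xJ - 1 ;;
    body)

def scaledExpr : Expr :=
  Expr.cell 0 (1 + 2 * (♯xU * ♯xN + ♯xV)) * (♯xD / Expr.cell 0 (2 + 2 * (♯xU * ♯xN + ♯xV)))

def lengthCode : Prog := xL ::= 0 ;; edgeLoop (xL ::= ♯xL + scaledExpr)

/-- Completion times are compared by cross-multiplication; the truncated difference is nonzero
exactly when vehicle `xI` is strictly better than `xB`. -/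
def bestCode : Prog :=
  xB ::= 0 ;; xI ::= 0 ;;
  .loop (♯xK - ♯xI)
    (.ite ((Expr.cell 3 ♯xB + ♯xL) * Expr.cell 0 (♯xS + ♯xI) - (Expr.cell 3 ♯xI + ♯xL) * Expr.cell 0 (♯xS + ♯xB))
      (xB ::= ♯xI) skip ;; xI ::= ♯xI + 1)

/-- Truncation makes `1 - next` the test that `v` is unvisited. The old link of `u` is copied to `v`
before it is overwritten. -/
def visitCode (u v : ℕ) : Prog :=
  .ite (next xB u * (1 - next xB v))
    (.store 4 (♯xB * ♯xN + ♯v) (next xB u) ;; .store 4 (♯xB * ♯xN + ♯u) (♯v + 1)) skip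

def growCode : Prog :=
  xH ::= ♯xN ;; .loop ♯xH (edgeLoop (visitCode xU xV ;; visitCode xV xU) ;; xH ::= ♯xH - 1)

def greedyCode : Prog :=
  .loop ♯xC (xC ::= ♯xC - 1 ;; xP ::= Expr.cell 2 ♯xC ;; xM ::= Expr.cell 0 ♯xP ;; xP ::= ♯xP + 1 ;;
    lengthCode ;; bestCode ;; .store 3 ♯xB (Expr.cell 3 ♯xB + ♯xL) ;; growCode)

/-- After the depot, `n` further vertices are emitted by following links; once the depot recurs it
is repeated, which is the padding of `closeTour`. The sum of the two truncated differences tests `xV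
≠ xR`. -/
def outputCode : Prog :=
  0 ::= 0 ;; xI ::= 0 ;;
  .loop (♯xK - ♯xI) (emit (♯xN + 1) ;; emit ♯xR ;; xV ::= next xI xR - 1 ;; xJ ::= ♯xN ;;
    .loop ♯xJ (emit ♯xV ;; .ite ((♯xV - ♯xR) + (♯xR - ♯xV)) (xV ::= next xI xV - 1) skip ;;
      xJ ::= ♯xJ - 1) ;;
    xI ::= ♯xI + 1)

def code : Prog :=
  denomCode ;; headerCode ;; initToursCode ;; parseCode ;; greedyCode ;; outputCode

end Program

/-! ## Correctness of the program -/

variable {B L : ℕ} {s : State} {Q : State → Prop}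

theorem wp_skip (h : Q s) : WP B L skip s Q := by
  refine WP.assign (fun hs => hs.1 0) ?_
  have : s.setReg 0 (s.reg 0) = s := by
    simp [State.setReg, Function.update_eq_self]
  simpa [this] using h

/-- The bounds on numbers and loops needed for the input `I`, `C`. -/
structure Budget (I : HTSP) (C : I.Collection) (B L : ℕ) : Prop where
  length : (I.encodeInput C).length ≤ L
  small : (L + 2) * (L + 2) < 2 ^ B
  denom : I.denom < 2 ^ B
  total : (C.flatten.map I.scaledLength).sum < 2 ^ B

/-- The constants of the program are set up. -/
structure Ready (I : HTSP) (C : I.Collection) (s : State) : Prop where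
  mem : s.mem 0 = I.input C
  n : s.reg 1 = I.n
  r : s.reg 2 = I.r
  k : s.reg 3 = I.k
  denom : s.reg 4 = I.denom
  speeds : s.reg 5 = I.depotPos + 2

/-- Frame rule: registers 1 to 5 hold the constants. Similar rules follow for the other invariants.
-/
theorem Ready.setReg (h : Ready I C s) {x : ℕ} (v : ℕ) (hx : x = 0 ∨ 6 ≤ x) :
    Ready I C (s.setReg x v) where
  mem := h.mem
  n := by rw [State.reg_setReg, if_neg (by omega), h.n]
  r := by rw [State.reg_setReg, if_neg (by omega), h.r]
  k := by rw [State.reg_setReg, if_neg (by omega), h.k]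
  denom := by rw [State.reg_setReg, if_neg (by omega), h.denom]
  speeds := by rw [State.reg_setReg, if_neg (by omega), h.speeds]

theorem Ready.setMem (h : Ready I C s) {a : ℕ} (i v : ℕ) (ha : 0 ≠ a) :
    Ready I C (s.setMem a i v) :=
  ⟨(State.mem_setMem_of_ne s i v ha).trans h.mem, h.n, h.r, h.k, h.denom, h.speeds⟩

/-- Each vertex of the list points to the next one, the last one to `z`
(the links are shifted by one). -/
def Linked {m : ℕ} (nx : Fin m → ℕ) (z : Fin m) : List (Fin m) → Prop
  | [] => True
  | a :: l => nx a = (l.headD z : ℕ) + 1 ∧ Linked nx z l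

/-- `nx` represents a tour under construction. -/
def Represents (I : HTSP) (nx : Fin I.n → ℕ) (l : List (Fin I.n)) : Prop :=
  (∀ u, u ∉ l → nx u = 0) ∧ Linked nx I.r l

theorem Linked.getElem {m : ℕ} {nx : Fin m → ℕ} {z : Fin m} {l : List (Fin m)}
    (h : Linked nx z l) {j : ℕ} (hj : j < l.length) : nx l[j] = (l.getD (j + 1) z : ℕ) + 1 := by
  induction l generalizing j with
  | nil => simp at hj
  | cons a l ih =>
    cases j with
    | zero =>
      have := h.1
      cases l <;> simpa using this
    | succ j =>
      have := ih h.2 (j := j) (by simpa using hj)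
      simpa using this

theorem Linked.congr {m : ℕ} {nx nx' : Fin m → ℕ} {z : Fin m} {l : List (Fin m)}
    (h : Linked nx z l) (h' : ∀ a ∈ l, nx' a = nx a) : Linked nx' z l := by
  induction l with
  | nil => trivial
  | cons a l ih =>
    exact ⟨(h' a (by simp)).trans h.1, ih h.2 fun a ha => h' a (by simp [ha])⟩

/-- Splicing changes only the links of `u` and `v`. Absence of duplicates ensures that the link of
`u` matters at one place only. -/
theorem Linked.insertAfter {m : ℕ} {nx nx' : Fin m → ℕ} {z u v : Fin m} {l : List (Fin m)}
    (h : Linked nx z l) (hl : l.Nodup) (hu : u ∈ l) (hv : v ∉ l) (hu' : nx' u = v + 1)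
    (hv' : nx' v = nx u) (hnx : ∀ a, a ≠ u → a ≠ v → nx' a = nx a) :
    Linked nx' z (insertAfter u v l) := by
  induction l with
  | nil => simp at hu
  | cons a l ih =>
    rw [List.nodup_cons] at hl
    rw [List.mem_cons, not_or] at hv
    rw [HTSP.insertAfter]
    split_ifs with ha
    · subst ha
      refine ⟨by simpa using hu', by rw [hv', h.1], h.2.congr fun b hb => hnx b ?_ ?_⟩
      · rintro rfl; exact hl.1 hb
      · rintro rfl; exact hv.2 hb
    · have hul : u ∈ l := by
        rcases List.mem_cons.1 hu with hu | hu
        · exact absurd hu.symm ha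
        · exact hu
      refine ⟨?_, ih h.2 hl.2 hul hv.2⟩
      rw [hnx a ha (Ne.symm hv.1), h.1, List.headD_eq_head?_getD, List.headD_eq_head?_getD,
        head?_insertAfter]

/-- Because links are shifted by one, membership in a tour is decided by reading a single cell. -/
theorem Represents.ne_zero_iff {nx : Fin I.n → ℕ} {l : List (Fin I.n)} (h : Represents I nx l)
    (u : Fin I.n) : nx u ≠ 0 ↔ u ∈ l := by
  constructor
  · intro hu
    by_contra hul
    exact hu (h.1 u hul)
  · intro hu
    obtain ⟨j, hj, rfl⟩ := List.getElem_of_mem hu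
    rw [h.2.getElem hj]
    exact Nat.succ_ne_zero _

theorem cell_inj {m i i' u u' : ℕ} (hu : u < m) (hu' : u' < m) :
    i * m + u = i' * m + u' ↔ i = i' ∧ u = u' := by
  constructor
  · intro h
    have h1 := congrArg (· / m) h
    have h2 := congrArg (· % m) h
    have hm : 0 < m := by omega
    simp only [add_comm _ u, add_comm _ u', Nat.add_mul_div_right _ _ hm,
      Nat.add_mul_mod_self_right, Nat.mod_eq_of_lt hu, Nat.mod_eq_of_lt hu',
      Nat.div_eq_of_lt hu, Nat.div_eq_of_lt hu'] at h1 h2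
    omega
  · rintro ⟨rfl, rfl⟩; rfl

/-- Loads and tours are represented in the memory. -/
structure Holds (I : HTSP) (load : Fin I.k → ℕ) (tour : Fin I.k → List (Fin I.n)) (s : State) :
    Prop where
  load : ∀ i : Fin I.k, s.mem 3 i = load i
  tour : ∀ i : Fin I.k, Represents I (fun u => s.mem 4 (i * I.n + u)) (tour i)

variable {load : Fin I.k → ℕ} {tour : Fin I.k → List (Fin I.n)}

theorem Holds.setMem (h : Holds I load tour s) {a : ℕ} (i v : ℕ) (h3 : 3 ≠ a) (h4 : 4 ≠ a) :
    Holds I load tour (s.setMem a i v) := by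
  constructor
  · rw [State.mem_setMem_of_ne _ _ _ h3]; exact h.load
  · rw [State.mem_setMem_of_ne _ _ _ h4]; exact h.tour

theorem Holds.setReg (h : Holds I load tour s) (x v : ℕ) : Holds I load tour (s.setReg x v) :=
  ⟨h.load, h.tour⟩

/-- The stack of positions of the trees in `l`. -/
def Stack (I : HTSP) (C : I.Collection) (l : List I.EdgeList) (s : State) : Prop :=
  s.reg 6 = l.length ∧ ∀ t (ht : t < l.length), Reads (I.input C) (s.mem 2 t) (I.encodeTree l[t]) ∧
    s.mem 2 t + (I.encodeTree l[t]).length ≤ (I.encodeInput C).length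

theorem Stack.setReg {l : List I.EdgeList} (h : Stack I C l s) {x : ℕ} (v : ℕ) (hx : 6 ≠ x) :
    Stack I C l (s.setReg x v) :=
  ⟨by rw [State.reg_setReg, if_neg hx, h.1], h.2⟩

theorem Stack.setMem {l : List I.EdgeList} (h : Stack I C l s) {a : ℕ} (i v : ℕ) (ha : 2 ≠ a) :
    Stack I C l (s.setMem a i v) := by
  refine ⟨h.1, ?_⟩
  rw [State.mem_setMem_of_ne _ _ _ ha]
  exact h.2

/-! ### Set-up -/

theorem Budget.n_le (hb : Budget I C B L) : I.n * I.n ≤ L := by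
  have := hb.length
  rw [length_encodeInput, depotPos] at this
  omega

theorem Budget.n_le' (hb : Budget I C B L) : I.n ≤ L :=
  (Nat.le_mul_self _).trans hb.n_le

theorem Budget.k_le (hb : Budget I C B L) : I.k ≤ L := by
  have := hb.length
  rw [length_encodeInput, depotPos] at this
  omega

theorem Budget.lt (hb : Budget I C B L) {a : ℕ} (ha : a ≤ L + 2) : a < 2 ^ B := by
  have := hb.small
  nlinarith

theorem wp_denomCode (hb : Budget I C B L) (hs : s.mem 0 = I.input C)
    (hm : ∀ a i, a ≠ 0 → s.mem a i = 0)
    (hQ : ∀ s, s.mem 0 = I.input C → (∀ a i, a ≠ 0 → s.mem a i = 0) → s.reg 1 = I.n →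
      s.reg 4 = I.denom → s.reg 7 = I.depotPos → Q s) : WP B L denomCode s Q := by
  obtain ⟨h0, h1, -⟩ := input_spec (C := C)
  refine WP.seq (WP.assign (fun h => h.2 _ _) ?_)
  refine WP.seq (WP.assign (fun _ => hb.lt (a := 1) (by omega)) ?_)
  refine WP.seq (WP.assign (fun _ => hb.lt (a := 1) (by omega)) ?_)
  refine WP.seq (WP.assign (fun _ => ?_) ?_)
  · simpa [hs, h0] using hb.lt (hb.n_le.trans (by omega))
  -- The register times the product of the unread denominators is always `denom`; as these are
  -- positive, the partial product cannot overflow.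
  refine WP.loop_list (fun (l : List ℚ) s => s.mem 0 = I.input C ∧
      (∀ a i, a ≠ 0 → s.mem a i = 0) ∧ s.reg 1 = I.n ∧ s.reg 12 = l.length ∧
      s.reg 7 + 2 * l.length = I.depotPos ∧ Reads (I.input C) (s.reg 7) (l.flatMap encodeRat) ∧
      s.reg 4 * (l.map Rat.den).prod = I.denom) I.dists ?_ ?_ ?_ ?_
  · rw [length_dists]; exact hb.n_le
  · simp [hs, h0, length_dists, depotPos, h1, denom]
    exact hm
  · rintro q l s ⟨hs, hm, hn, hi, hp, hr, hd⟩
    rw [List.flatMap_cons, encodeRat, List.cons_append, List.cons_append, reads_cons,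
      reads_cons] at hr
    simp only [List.length_cons] at hi hp
    rw [List.map_cons, List.prod_cons, ← mul_assoc] at hd
    have hlen := hb.length
    rw [length_encodeInput] at hlen
    refine ⟨by simp [hi], ?_⟩
    refine WP.seq (WP.assign (fun _ => ?_) ?_)
    · simp only [val_mul, val_reg, val_cell, val_add, val_ofNat, hs, xD, xP, hr.2.1]
      refine lt_of_le_of_lt ?_ hb.denom
      rw [← hd]
      refine Nat.le_mul_of_pos_right _ (List.prod_pos fun a ha => ?_)
      obtain ⟨q, -, rfl⟩ := List.mem_map.1 ha
      exact q.den_pos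
    refine WP.seq (WP.assign (fun _ => hb.lt ?_) ?_)
    · simp; omega
    refine WP.assign (fun _ => hb.lt ?_) ?_
    · have := hb.n_le
      simp; rw [depotPos] at hp hlen; omega
    · simp [hs, hr.2.1, hn, hi, hd]
      exact ⟨hm, by omega, hr.2.2⟩
  · rintro s ⟨hs, hm, hn, hi, hp, -, hd⟩
    exact ⟨by simpa using hi, hQ s hs hm hn (by simpa using hd) (by simpa using hp)⟩

theorem Budget.pos_le (hb : Budget I C B L) :
    I.depotPos + 3 + I.k + (C.flatMap I.encodeClass).length ≤ L := by
  have := hb.length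
  rw [length_encodeInput] at this
  omega

theorem wp_headerCode (hb : Budget I C B L) (hs : s.mem 0 = I.input C)
    (hm : ∀ a i, a ≠ 0 → s.mem a i = 0) (hn : s.reg 1 = I.n) (hd : s.reg 4 = I.denom)
    (hp : s.reg 7 = I.depotPos)
    (hQ : ∀ s, Ready I C s → (∀ a i, a ≠ 0 → s.mem a i = 0) → s.reg 7 = I.depotPos + 2 + I.k →
      Q s) : WP B L headerCode s Q := by
  obtain ⟨-, -, hr, hk, -⟩ := input_spec (C := C)
  have hlen := hb.pos_le
  refine WP.seq (WP.assign (fun h => h.2 _ _) ?_)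
  refine WP.seq (WP.assign (fun h => h.2 _ _) ?_)
  refine WP.seq (WP.assign (fun _ => hb.lt ?_) ?_)
  · simp [hp]; omega
  refine WP.assign (fun _ => hb.lt ?_) ?_
  · simp [hs, hp, hk]; omega
  refine hQ _ ?_ hm ?_
  · constructor <;> simp [hs, hn, hd, hp, hr, hk]
  · simp [hs, hp, hk]

theorem wp_initToursCode (hb : Budget I C B L) (hs : Ready I C s)
    (hm : ∀ a i, a ≠ 0 → s.mem a i = 0)
    (hQ : ∀ s', Ready I C s' → s'.reg 7 = s.reg 7 → Holds I (fun _ => 0) (fun _ => [I.r]) s' →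
      Q s') : WP B L initToursCode s Q := by
  have hn := hb.n_le'
  have hk := hb.k_le
  refine WP.seq (WP.assign (fun _ => hb.lt (a := 0) (by omega)) ?_)
  -- Zeroed memory already encodes zero loads and unvisited vertices; only the link from the depot
  -- to itself is written, for each vehicle.
  refine WP.loop_count (fun i s' => Ready I C s' ∧ s'.reg 7 = s.reg 7 ∧ s'.reg 12 = i ∧
    (∀ j, s'.mem 3 j = 0) ∧ ∀ (j : ℕ) (u : Fin I.n), s'.mem 4 (j * I.n + u) =
      if j < i ∧ u = I.r then (I.r : ℕ) + 1 else 0) I.k hk ?_ ?_ ?_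
  · exact ⟨hs.setReg _ (by simp), by simp, by simp, by simpa using fun j => hm 3 j (by simp),
      by simpa using fun j (u : Fin I.n) => hm 4 (j * I.n + u) (by simp)⟩
  · rintro i s' hik ⟨hs', h7, hi, h3, h4⟩
    refine ⟨by simp [hs'.k, hi]; omega, ?_⟩
    refine WP.seq (WP.store (fun _ => hb.lt ?_) ?_)
    · have := I.r.2
      simp [hs'.r]; omega
    refine WP.assign (fun _ => hb.lt ?_) ?_
    · simp [hi]; omega
    refine ⟨(hs'.setMem _ _ (by simp)).setReg _ (by simp), by simpa using h7, by simp [hi], ?_, ?_⟩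
    · intro j
      rw [State.mem_setReg, State.mem_setMem_of_ne _ _ _ (by simp)]
      exact h3 j
    · intro j u
      rw [State.mem_setReg, State.mem_setMem, Function.update_apply]
      simp only [val_add, val_mul, val_reg, xI, xN, xR, hi, hs'.n, hs'.r, val_ofNat,
        cell_inj u.2 I.r.2, h4, Fin.val_inj]
      by_cases hu : u = I.r
      · by_cases hj : j = i
        · simp [hu, hj]
        · have : j < i + 1 ↔ j < i := by omega
          simp [hu, hj, this]
      · simp [hu]
  · rintro s' ⟨hs', h7, hi, h3, h4⟩
    refine ⟨by simp [hs'.k, hi], hQ s' hs' h7 ⟨fun i => h3 i, fun i => ⟨fun u hu => ?_, ?_, trivial⟩⟩⟩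
    · rw [List.mem_singleton] at hu
      simp [h4, hu]
    · simp [h4]

theorem length_flatten_le (C : I.Collection) :
    C.flatten.length ≤ (C.flatMap I.encodeClass).length := by
  induction C with
  | nil => simp
  | cons 𝒯 C ih =>
    have h := length_le_length_flatMap (g := I.encodeTree) (fun a => by simp [encodeTree]) 𝒯
    rw [List.flatten_cons, List.flatMap_cons, List.length_append, List.length_append, encodeClass,
      List.length_cons]
    omega

theorem wp_parseCode (hb : Budget I C B L) (hs : Ready I C s) (hh : Holds I load tour s)
    (hp : s.reg 7 = I.depotPos + 2 + I.k)
    (hQ : ∀ s, Ready I C s → Holds I load tour s → Stack I C C.flatten s → Q s) :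
    WP B L parseCode s Q := by
  obtain ⟨-, -, -, -, -, hc, hC⟩ := input_spec (C := C)
  have hlen := hb.length
  have hlen' := length_encodeInput (C := C)
  refine WP.seq (WP.assign (fun _ => hb.lt (a := 0) (by omega)) ?_)
  refine WP.seq (WP.assign (fun h => h.2 _ _) ?_)
  refine WP.seq (WP.assign (fun _ => hb.lt ?_) ?_)
  · simp [hp]; omega
  -- The stack holds the trees of the classes already read, and the unread word encodes the others.
  -- The inner loop splits the current class in the same way.
  refine WP.loop_list (fun (rest : I.Collection) s => ∃ done, done ++ rest = C ∧ Ready I C s ∧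
    Holds I load tour s ∧ Stack I C done.flatten s ∧ s.reg 12 = rest.length ∧
    Reads (I.input C) (s.reg 7) (rest.flatMap I.encodeClass) ∧
    s.reg 7 + (rest.flatMap I.encodeClass).length = (I.encodeInput C).length) C ?_ ?_ ?_ ?_
  · have := length_le_length_flatMap (g := I.encodeClass) (fun a => by simp [encodeClass]) C
    omega
  · refine ⟨[], rfl, ?_, ?_, ?_, ?_⟩
    · exact ((hs.setReg _ (by simp)).setReg _ (by simp)).setReg _ (by simp)
    · exact ((hh.setReg _ _).setReg _ _).setReg _ _
    · exact ⟨by simp, by simp⟩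
    · simp [hs.mem, hp, hc, -List.length_flatMap]
      exact ⟨hC, by omega⟩
  · rintro 𝒯 rest s ⟨done, hdone, hs, hh, hst, hi, hr, hpos⟩
    rw [List.flatMap_cons, reads_append, encodeClass, reads_cons] at hr
    rw [List.flatMap_cons, encodeClass, List.length_append, List.length_cons] at hpos
    rw [List.length_cons] at hi
    have h𝒯 := length_le_length_flatMap (g := I.encodeTree) (fun a => by simp [encodeTree]) 𝒯
    have hrest := length_le_length_flatMap (g := I.encodeClass) (fun a => by simp [encodeClass])
      rest
    refine ⟨by simp [hi], ?_⟩
    refine WP.seq (WP.assign (fun h => h.2 _ _) ?_)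
    refine WP.seq (WP.assign (fun _ => hb.lt ?_) ?_)
    · simp; omega
    refine WP.seq (WP.assign (fun _ => hb.lt ?_) ?_)
    · simp [hi]; omega
    refine WP.loop_list (fun (rest' : List I.EdgeList) s => ∃ done', done' ++ rest' = 𝒯 ∧
      Ready I C s ∧ Holds I load tour s ∧ Stack I C (done.flatten ++ done') s ∧
      s.reg 12 = rest.length ∧ s.reg 14 = rest'.length ∧
      Reads (I.input C) (s.reg 7) (rest'.flatMap I.encodeTree ++ rest.flatMap I.encodeClass) ∧
      s.reg 7 + (rest'.flatMap I.encodeTree).length + (rest.flatMap I.encodeClass).length =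
        (I.encodeInput C).length) 𝒯 ?_ ?_ ?_ ?_
    · omega
    · refine ⟨[], rfl, ?_, ?_, ?_, ?_⟩
      · exact ((hs.setReg _ (by simp)).setReg _ (by simp)).setReg _ (by simp)
      · exact ((hh.setReg _ _).setReg _ _).setReg _ _
      · rw [List.append_nil]
        exact ((hst.setReg _ (by simp)).setReg _ (by simp)).setReg _ (by simp)
      · simp [hs.mem, hi, hr.1, reads_append, -List.length_flatMap]
        refine ⟨?_, by omega⟩
        have := hr.2
        rw [List.length_cons] at this
        rwa [add_assoc, add_comm 1]
    · rintro T rest' s ⟨done', hdone', hs, hh, hst, hi, hj, hr, hpos⟩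
      rw [List.flatMap_cons, List.append_assoc, reads_append] at hr
      rw [List.flatMap_cons, List.length_append] at hpos
      rw [List.length_cons] at hj
      have hT : (I.encodeTree T).length = 1 + 2 * T.length := by
        rw [encodeTree_eq, List.length_cons, length_flatMap_ends]; omega
      have hT0 : I.input C (s.reg 7) = T.length := by
        have := hr.1
        rw [encodeTree_eq, reads_cons] at this
        exact this.1
      have hj𝒯 : rest'.length + 1 ≤ 𝒯.length := by rw [← hdone']; simp
      -- Every tree uses at least one entry of the input word, which bounds the height of the stack.
      have hcnt : s.reg 6 + 1 ≤ L := by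
        have := length_flatten_le C
        have h1 := congrArg (fun C => (List.flatten C).length) hdone
        have h2 := congrArg List.length hdone'
        simp only [List.flatten_append, List.flatten_cons, List.length_append, List.length_cons]
          at h1 h2
        rw [hst.1, List.length_append]
        omega
      refine ⟨by simp [hj], ?_⟩
      refine WP.seq (WP.store (fun h => h.1 _) ?_)
      refine WP.seq (WP.assign (fun _ => hb.lt ?_) ?_)
      · simp; omega
      have hmem : ∀ i v, (s.setMem 2 i v).mem 0 = I.input C := fun i v =>
        (State.mem_setMem_of_ne _ _ _ (by simp)).trans hs.mem
      refine WP.seq (WP.assign (fun _ => hb.lt ?_) ?_)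
      · simp [hmem, hT0]; omega
      refine WP.assign (fun _ => hb.lt ?_) ?_
      · simp [hj]; omega
      refine ⟨done' ++ [T], by simpa using hdone', ?_, ?_, ?_, ?_⟩
      · exact (((hs.setMem _ _ (by simp)).setReg _ (by simp)).setReg _ (by simp)).setReg _ (by simp)
      · exact (((hh.setMem _ _ (by simp) (by simp)).setReg _ _).setReg _ _).setReg _ _
      · refine ⟨by simp [hst.1]; omega, fun t ht => ?_⟩
        simp only [State.mem_setReg, State.mem_setMem, val_reg, xC, xP, hst.1]
        rcases eq_or_ne t (done.flatten ++ done').length with rfl | hne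
        · simp only [← List.append_assoc, Function.update_self, List.getElem_concat_length]
          exact ⟨hr.1, by omega⟩
        · have ht' : t < (done.flatten ++ done').length := by
            simp only [List.length_append, List.length_cons, List.length_nil] at ht hne ⊢; omega
          rw [Function.update_of_ne hne]
          simp only [← List.append_assoc, List.getElem_append_left ht']
          exact hst.2 t ht'
      · simp [hmem, hT0, hi, hj, -List.length_flatMap]
        rw [hT] at hr hpos
        rw [show s.reg 7 + 1 + 2 * T.length = s.reg 7 + (1 + 2 * T.length) by omega]
        exact ⟨hr.2, by omega⟩
    · rintro s ⟨done', hdone', hs, hh, hst, hi, hj, hr, hpos⟩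
      rw [List.append_nil] at hdone'
      refine ⟨by simpa using hj, done ++ [𝒯], by simpa using hdone, hs, hh, ?_, hi, ?_, ?_⟩
      · simpa [hdone'] using hst
      · simpa using hr
      · simpa [-List.length_flatMap] using hpos
  · rintro s ⟨done, hdone, hs, hh, hst, hi, -⟩
    rw [List.append_nil] at hdone
    subst hdone
    exact ⟨by simpa using hi, hQ s hs hh hst⟩

/-! ### Processing a tree -/

/-- The state while the tree `T` is processed and the trees in `l` are left. -/
structure Work (I : HTSP) (C : I.Collection) (l : List I.EdgeList) (T : I.EdgeList)
    (load : Fin I.k → ℕ) (tour : Fin I.k → List (Fin I.n)) (s : State) : Prop where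
  ready : Ready I C s
  holds : Holds I load tour s
  stack : Stack I C l s
  edges : Reads (I.input C) (s.reg 7) (T.flatMap I.ends)
  pos : s.reg 7 + 2 * T.length ≤ (I.encodeInput C).length
  count : s.reg 8 = T.length

variable {l : List I.EdgeList} {T : I.EdgeList}

theorem Work.setReg (h : Work I C l T load tour s) {x : ℕ} (v : ℕ) (hx : 9 ≤ x) :
    Work I C l T load tour (s.setReg x v) where
  ready := h.ready.setReg v (by omega)
  holds := h.holds.setReg x v
  stack := h.stack.setReg v (by omega)
  edges := by rw [State.reg_setReg, if_neg (by omega)]; exact h.edges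
  pos := by rw [State.reg_setReg, if_neg (by omega)]; exact h.pos
  count := by rw [State.reg_setReg, if_neg (by omega)]; exact h.count

theorem Work.setMem (h : Work I C l T load tour s) {a i v : ℕ} {load' : Fin I.k → ℕ}
    {tour' : Fin I.k → List (Fin I.n)} (ha : a = 3 ∨ a = 4)
    (hh : Holds I load' tour' (s.setMem a i v)) : Work I C l T load' tour' (s.setMem a i v) where
  ready := h.ready.setMem i v (by omega)
  holds := hh
  stack := h.stack.setMem i v (by omega)
  edges := h.edges
  pos := h.pos
  count := h.count

/-- `K` is indexed by the edges still to come. It must be insensitive to the registers from 13 on,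
which include those the loop uses itself. -/
theorem wp_edgeLoop (hb : Budget I C B L) {body : Prog} (K : I.EdgeList → State → Prop)
    (hw : Work I C l T load tour s)
    (hmem : ∀ rest s, K rest s → s.mem 0 = I.input C)
    (hset : ∀ rest s x v, 13 ≤ x → K rest s → K rest (s.setReg x v)) (h0 : K T s)
    (hbody : ∀ e rest s, K (e :: rest) s → s.reg 15 = e.1 → s.reg 16 = e.2 →
      WP B L body s fun s' => K rest s' ∧ s'.reg 13 = s.reg 13 ∧ s'.reg 14 = s.reg 14)
    (hQ : ∀ s, K [] s → Q s) : WP B L (edgeLoop body) s Q := by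
  have hlen := hb.length
  have hpos := hw.pos
  refine WP.seq (WP.assign (fun h => h.1 _) ?_)
  refine WP.seq (WP.assign (fun h => h.1 _) ?_)
  refine WP.loop_list (fun (rest : I.EdgeList) s => K rest s ∧ s.reg 14 = rest.length ∧
    Reads (I.input C) (s.reg 13) (rest.flatMap I.ends) ∧ s.reg 13 + 2 * rest.length ≤ L) T
    (by omega) ?_ ?_ ?_
  · refine ⟨hset _ _ _ _ (by simp) (hset _ _ _ _ (by simp) h0), by simp [hw.count], ?_, ?_⟩
    · simpa using hw.edges
    · simp; omega
  · rintro e rest s ⟨hK, hj, hr, hp⟩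
    have hs := hmem _ _ hK
    rw [List.flatMap_cons, ends, List.cons_append, List.cons_append, reads_cons, reads_cons] at hr
    rw [List.length_cons] at hj hp
    refine ⟨by simp [hj], ?_⟩
    refine WP.seq (WP.assign (fun h => h.2 _ _) ?_)
    refine WP.seq (WP.assign (fun h => h.2 _ _) ?_)
    refine WP.seq (WP.assign (fun _ => hb.lt ?_) ?_)
    · simp; omega
    refine WP.seq (WP.assign (fun _ => hb.lt ?_) ?_)
    · simp [hj]; omega
    refine (hbody e rest _ ?_ ?_ ?_).mono ?_
    · exact hset _ _ _ _ (by simp) (hset _ _ _ _ (by simp) (hset _ _ _ _ (by simp)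
        (hset _ _ _ _ (by simp) hK)))
    · simp [hs, hr.1]
    · simp [hs, hr.2.1]
    · rintro s' ⟨hK', h13, h14⟩
      refine ⟨hK', by simp [h14, hj], ?_, ?_⟩
      · have := hr.2.2
        simpa [h13] using this
      · simp [h13]; omega
  · rintro s ⟨hK, hj, -⟩
    exact ⟨by simpa using hj, hQ s hK⟩

theorem val_scaledExpr (hs : Ready I C s) {u v : Fin I.n} (hu : s.reg 15 = u) (hv : s.reg 16 = v) :
    scaledExpr.val s = I.scaled u v := by
  have := input_dist (C := C) u v
  simp [scaledExpr, hs.n, hs.mem, hs.denom, hu, hv, this.1, this.2, scaled]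

theorem wp_lengthCode (hb : Budget I C B L) (hw : Work I C l T load tour s)
    (hT : I.scaledLength T < 2 ^ B)
    (hQ : ∀ s, Work I C l T load tour s → s.reg 9 = I.scaledLength T → Q s) :
    WP B L lengthCode s Q := by
  refine WP.seq (WP.assign (fun _ => hb.lt (a := 0) (by omega)) ?_)
  refine wp_edgeLoop hb (fun rest s => Work I C l T load tour s ∧
    s.reg 9 + I.scaledLength rest = I.scaledLength T) (hw.setReg _ (by simp))
    (fun _ _ h => h.1.ready.mem) ?_ ?_ ?_ ?_
  · rintro rest s x v hx ⟨hw, h⟩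
    exact ⟨hw.setReg _ (by omega), by rwa [State.reg_setReg, if_neg (by omega)]⟩
  · exact ⟨hw.setReg _ (by simp), by simp⟩
  · rintro e rest s ⟨hw, h⟩ hu hv
    rw [scaledLength, List.map_cons, List.sum_cons, ← add_assoc, ← scaledLength] at h
    have hval := val_scaledExpr hw.ready hu hv
    refine WP.assign (fun _ => ?_) ⟨⟨hw.setReg _ (by simp), ?_⟩, ?_, ?_⟩
    · simp [hval]; omega
    · simpa [hval] using h
    · simp
    · simp
  · rintro s ⟨hw, h⟩
    exact hQ s hw (by simpa [scaledLength] using h)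

theorem wp_bestCode (hb : Budget I C B L) (hw : Work I C l T load tour s)
    (hl : s.reg 9 = I.scaledLength T)
    (hQ : ∀ s (b : Fin I.k), Work I C l T load tour s → s.reg 9 = I.scaledLength T →
      s.reg 10 = b → IsBest load (I.scaledLength T) b → Q s) :
    WP B L bestCode s Q := by
  have hk := hb.k_le
  refine WP.seq (WP.assign (fun _ => hb.lt (a := 0) (by omega)) ?_)
  refine WP.seq (WP.assign (fun _ => hb.lt (a := 0) (by omega)) ?_)
  refine WP.loop_count (fun i s => Work I C l T load tour s ∧ s.reg 9 = I.scaledLength T ∧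
    s.reg 12 = i ∧ ∃ b : Fin I.k, s.reg 10 = b ∧ ∀ i' : Fin I.k, (i' : ℕ) < i →
      (load b + I.scaledLength T) * I.speed i' ≤ (load i' + I.scaledLength T) * I.speed b)
    I.k hk ?_ ?_ ?_
  · exact ⟨(hw.setReg _ (by simp)).setReg _ (by simp), by simpa using hl, by simp,
      ⟨0, I.k_pos⟩, by simp, by simp⟩
  · rintro i s hik ⟨hw, hl, hi, b, hxb, hbest⟩
    refine ⟨by simp [hw.ready.k, hi]; omega, ?_⟩
    have hval : ((Expr.cell 3 (.reg 10) + .reg 9) * Expr.cell 0 (.reg 5 + .reg 12) -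
        (Expr.cell 3 (.reg 12) + .reg 9) * Expr.cell 0 (.reg 5 + .reg 10)).val s =
        (load b + I.scaledLength T) * I.speed ⟨i, hik⟩ -
          (load ⟨i, hik⟩ + I.scaledLength T) * I.speed b := by
      have h1 := input_speed (C := C) b
      have h2 := input_speed (C := C) ⟨i, hik⟩
      have h3 := hw.holds.load b
      have h4 := hw.holds.load ⟨i, hik⟩
      simp only at h1 h2 h3 h4
      simp [hw.ready.mem, hw.ready.speeds, hl, hi, hxb, h1, h2, h3, h4]
    refine WP.seq (WP.mono (Q := fun s => Work I C l T load tour s ∧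
      s.reg 9 = I.scaledLength T ∧ s.reg 12 = i ∧ ∃ b : Fin I.k, s.reg 10 = b ∧
      ∀ i' : Fin I.k, (i' : ℕ) < i + 1 →
      (load b + I.scaledLength T) * I.speed i' ≤ (load i' + I.scaledLength T) * I.speed b)
      (WP.ite (fun hne => ?_) (fun he => ?_)) ?_)
    · have hlt := Nat.sub_ne_zero_iff_lt.1 (fun h => hne (hval.trans h))
      refine WP.assign (fun h => h.1 _) ⟨hw.setReg _ (by simp), by simpa using hl, by simpa using hi,
        ⟨i, hik⟩, by simp [hi], fun i' hi' => ?_⟩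
      rcases Nat.lt_succ_iff_lt_or_eq.1 hi' with h | h
      -- Transitivity of a comparison of fractions: multiply by the speed of the former best vehicle
      -- `b`, chain the two inequalities, and cancel.
      · refine Nat.le_of_mul_le_mul_right ?_ (speed_pos b)
        have h1 := Nat.mul_le_mul_right (I.speed i') hlt.le
        have h2 := Nat.mul_le_mul_right (I.speed ⟨i, hik⟩) (hbest i' h)
        calc _ = (load ⟨i, hik⟩ + I.scaledLength T) * I.speed b * I.speed i' := by ring
          _ ≤ _ := h1
          _ = (load b + I.scaledLength T) * I.speed i' * I.speed ⟨i, hik⟩ := by ring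
          _ ≤ _ := h2
          _ = _ := by ring
      · have : i' = ⟨i, hik⟩ := Fin.ext h
        rw [this]
    · replace he := hval.symm.trans he
      refine wp_skip ⟨hw, hl, hi, b, hxb, fun i' hi' => ?_⟩
      rcases Nat.lt_succ_iff_lt_or_eq.1 hi' with h | h
      · exact hbest i' h
      · have : i' = ⟨i, hik⟩ := Fin.ext h
        rw [this]
        exact Nat.sub_eq_zero_iff_le.1 he
    · rintro s ⟨hw, hl, hi, b, hxb, hbest⟩
      refine WP.assign (fun _ => hb.lt ?_) ⟨hw.setReg _ (by simp), by simpa using hl,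
        by simp [hi], b, by simpa using hxb, hbest⟩
      simp [hi]; omega
  · rintro s ⟨hw, hl, hi, b, hxb, hbest⟩
    exact ⟨by simp [hw.ready.k, hi], hQ s b hw hl hxb fun i => hbest i i.2⟩

theorem Holds.setMem_load (h : Holds I load tour s) (b : Fin I.k) (v : ℕ) :
    Holds I (Function.update load b v) tour (s.setMem 3 b v) := by
  refine ⟨fun i => ?_, ?_⟩
  · rw [State.mem_setMem, Function.update_apply, Function.update_apply, h.load]
    simp only [Fin.val_inj]
  · rw [State.mem_setMem_of_ne _ _ _ (by simp)]
    exact h.tour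

theorem wp_visitCode {b : Fin I.k} {L' : List (Fin I.n)} {u v : Fin I.n} {xu xv : ℕ}
    (hb : Budget I C B L) (hw : Work I C l T load (Function.update tour b L') s)
    (hL : I.Simple L') (hxb : s.reg 10 = b) (hu : s.reg xu = u) (hv : s.reg xv = v)
    (hQ : ∀ s', Work I C l T load (Function.update tour b (I.visit L' u v)) s' →
      s'.reg = s.reg → Q s') : WP B L (visitCode xu xv) s Q := by
  have hn := hb.n_le'
  have hrep := hw.holds.tour b
  rw [Function.update_self] at hrep
  have hval : ∀ (x : ℕ) (a : Fin I.n), s.reg x = a → (HTSP.next xB x).val s =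
      s.mem 4 (b * I.n + a) := by
    intro x a hx
    simp [HTSP.next, hxb, hx, hw.ready.n]
  have hcond : (HTSP.next xB xu * (1 - HTSP.next xB xv)).val s ≠ 0 ↔ u ∈ L' ∧ v ∉ L' := by
    have h1 := hrep.ne_zero_iff u
    have h2 := hrep.ne_zero_iff v
    simp only [val_mul, val_sub, val_ofNat, hval xu u hu, hval xv v hv, ← h1, ← h2, mul_ne_zero_iff]
    omega
  refine WP.ite (fun h => ?_) (fun h => ?_)
  · rw [hcond] at h
    have huv : u ≠ v := by rintro rfl; exact h.2 h.1
    refine WP.seq (WP.store (fun hs => ?_) ?_)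
    · rw [hval xu u hu]; exact hs.2 _ _
    refine WP.store (fun _ => hb.lt ?_) ?_
    · have := v.2
      simp [hv]; omega
    have e1 : (Expr.reg xB * Expr.reg xN + Expr.reg xv).val s = b * I.n + v := by
      simp [hxb, hw.ready.n, hv]
    have e2 : ∀ s' : State, s'.reg = s.reg →
        (Expr.reg xB * Expr.reg xN + Expr.reg xu).val s' = b * I.n + u := by
      intro s' h'
      simp [h', hxb, hw.ready.n, hu]
    have e3 : ∀ s' : State, s'.reg = s.reg → (Expr.reg xv + 1).val s' = v + 1 := by
      intro s' h'
      simp [h', hv]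
    rw [e1, e2 (s.setMem _ _ _) rfl, e3 (s.setMem _ _ _) rfl, show (HTSP.next xB xu).val s = _ from hval xu u hu]
    refine hQ _ ?_ rfl
    -- By `cell_inj` the two stores hit no other cell of the table.
    have hcell : ∀ (i : Fin I.k) (a : Fin I.n),
        (((s.setMem 4 (b * I.n + v) (s.mem 4 (b * I.n + u))).setMem 4 (b * I.n + u) (v + 1)).mem 4
          (i * I.n + a)) = if i = b ∧ a = u then (v : ℕ) + 1 else if i = b ∧ a = v then
            s.mem 4 (b * I.n + u) else s.mem 4 (i * I.n + a) := by
      intro i a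
      simp only [State.mem_setMem, Function.update_apply, cell_inj a.2 u.2, cell_inj a.2 v.2,
        Fin.val_inj]
    have hload : ∀ i : Fin I.k, ((s.setMem 4 (b * I.n + v) (s.mem 4 (b * I.n + u))).setMem 4
        (b * I.n + u) (v + 1)).mem 3 i = load i := by
      intro i
      rw [State.mem_setMem_of_ne _ _ _ (by simp), State.mem_setMem_of_ne _ _ _ (by simp)]
      exact hw.holds.load i
    refine ⟨(hw.ready.setMem _ _ (by simp)).setMem _ _ (by simp), ⟨hload, fun i => ?_⟩,
      (hw.stack.setMem _ _ (by simp)).setMem _ _ (by simp), hw.edges, hw.pos, hw.count⟩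
    simp only [hcell]
    rcases eq_or_ne i b with rfl | hib
    · rw [Function.update_self, visit, if_pos h]
      simp only [true_and]
      refine ⟨fun a ha => ?_, hrep.2.insertAfter hL.1 h.1 h.2 (by simp) (by simp [huv.symm])
        fun a hau hav => by simp [hau, hav]⟩
      rw [(insertAfter_perm h.1).mem_iff, List.mem_cons, not_or] at ha
      have hau : a ≠ u := by rintro rfl; exact ha.2 h.1
      simp only [hau, ha.1, if_false]
      exact hrep.1 a ha.2
    · have := hw.holds.tour i
      simpa [hib] using this
  · refine wp_skip (hQ s ?_ rfl)
    rw [visit, if_neg]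
    · exact hw
    · rw [← hcond, not_not]; exact h

theorem wp_growCode {b : Fin I.k} (hb : Budget I C B L) (hw : Work I C l T load tour s)
    (hL : I.Simple (tour b)) (hxb : s.reg 10 = b)
    (hQ : ∀ s', Work I C l T load (Function.update tour b (I.grow T (tour b))) s' → Q s') :
    WP B L growCode s Q := by
  have hn := hb.n_le'
  refine WP.seq (WP.assign (fun h => h.1 _) ?_)
  refine WP.loop_count (fun i s => s.reg 10 = b ∧ s.reg 11 = I.n - i ∧
    Work I C l T load (Function.update tour b ((I.sweep T)^[i] (tour b))) s) I.n hn ?_ ?_ ?_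
  · refine ⟨by simpa using hxb, by simp [hw.ready.n], ?_⟩
    rw [Function.iterate_zero, id, Function.update_eq_self]
    exact hw.setReg _ (by simp)
  · rintro i s hi ⟨hxb, hh, hw⟩
    have hsimple := hL.iterate T i
    refine ⟨by simp [hh]; omega, ?_⟩
    rw [Function.iterate_succ_apply', sweep]
    generalize (I.sweep T)^[i] (tour b) = L' at *
    -- Within a sweep, processing the remaining edges from the current tour gives the same result as
    -- the full sweep from `L'`.
    refine WP.seq (wp_edgeLoop hb (fun rest s => s.reg 10 = b ∧ s.reg 11 = I.n - i ∧ ∃ L'',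
      I.Simple L'' ∧ rest.foldl I.visitEdge L'' = T.foldl I.visitEdge L' ∧
      Work I C l T load (Function.update tour b L'') s) hw ?_ ?_ ?_ ?_ ?_)
    · rintro rest s ⟨-, -, L'', -, -, hw⟩
      exact hw.ready.mem
    · rintro rest s x v hx ⟨h1, h2, L'', h3, h4, hw⟩
      refine ⟨?_, ?_, L'', h3, h4, hw.setReg _ (by omega)⟩
      · rwa [State.reg_setReg, if_neg (by omega)]
      · rwa [State.reg_setReg, if_neg (by omega)]
    · exact ⟨hxb, hh, L', hsimple, rfl, hw⟩
    · rintro e rest s ⟨h1, h2, L'', h3, h4, hw⟩ hu hv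
      refine WP.seq (wp_visitCode hb hw h3 h1 hu hv fun s₁ hw₁ hs₁ => ?_)
      refine wp_visitCode hb hw₁ (h3.visit _ _) (by rw [hs₁, h1]) (by rw [hs₁]; exact hv)
        (by rw [hs₁]; exact hu) fun s₂ hw₂ hs₂ => ?_
      rw [hs₂, hs₁]
      exact ⟨⟨h1, h2, _, h3.visitEdge e, h4, hw₂⟩, rfl, rfl⟩
    · rintro s ⟨h1, h2, L'', h3, h4, hw⟩
      rw [List.foldl_nil] at h4
      subst h4
      refine WP.assign (fun _ => hb.lt ?_) ⟨by simpa using h1, ?_, hw.setReg _ (by simp)⟩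
      · simp [h2]; omega
      · simp [h2]; omega
  · rintro s ⟨hxb, hh, hw⟩
    exact ⟨by simp [hh], hQ s hw⟩

theorem wp_greedyCode (hb : Budget I C B L) (hs : Ready I C s) (hst : Stack I C C.flatten s)
    (hh : Holds I (fun _ => 0) (fun _ => [I.r]) s)
    (hQ : ∀ s load tour, Ready I C s → Holds I load tour s → Greedy C.flatten load tour → Q s) :
    WP B L greedyCode s Q := by
  have hlen := hb.length
  have hpos := hb.pos_le
  have hfl := length_flatten_le C
  -- The loop list is the reversed list of unplaced trees, so its head is the top of the stack; `l₂`
  -- is the suffix already placed.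
  refine WP.loop_list (fun (l : List I.EdgeList) s => ∃ l₂ load tour, C.flatten = l.reverse ++ l₂ ∧
    Ready I C s ∧ Stack I C l.reverse s ∧ Holds I load tour s ∧ Greedy l₂ load tour)
    C.flatten.reverse ?_ ?_ ?_ ?_
  · rw [List.length_reverse]; omega
  · exact ⟨[], _, _, by simp, hs, by simpa using hst, hh, .nil⟩
  · rintro T l s ⟨l₂, load, tour, hl, hs, hst, hh, hg⟩
    rw [List.reverse_cons] at hl hst
    have hcnt : s.reg 6 = l.reverse.length + 1 := by rw [hst.1]; simp
    have hread := hst.2 l.reverse.length (by simp)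
    rw [List.getElem_concat_length rfl, encodeTree_eq, List.length_cons, length_flatMap_ends,
      reads_cons] at hread
    have htot : (l₂.map I.scaledLength).sum + I.scaledLength T < 2 ^ B := by
      refine lt_of_le_of_lt ?_ hb.total
      rw [hl]
      simp only [List.map_append, List.sum_append, List.map_cons, List.map_nil, List.sum_cons,
        List.sum_nil]
      omega
    refine ⟨by simp [hcnt], ?_⟩
    refine WP.seq (WP.assign (fun h => lt_of_le_of_lt (Nat.sub_le _ _) (h.1 6)) ?_)
    refine WP.seq (WP.assign (fun h => h.2 _ _) ?_)
    refine WP.seq (WP.assign (fun h => h.2 _ _) ?_)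
    refine WP.seq (WP.assign (fun _ => hb.lt ?_) ?_)
    · simp [hcnt]; simp at hread; omega
    rw [List.length_reverse] at hread hcnt
    refine WP.seq (wp_lengthCode (l := l.reverse) (T := T) (load := load) (tour := tour) hb ?_ ?_
      fun s hw hlen => ?_)
    · refine ⟨?_, ?_, ⟨?_, ?_⟩, ?_, ?_, ?_⟩
      · exact (((hs.setReg _ (by simp)).setReg _ (by simp)).setReg _ (by simp)).setReg _ (by simp)
      · exact (((hh.setReg _ _).setReg _ _).setReg _ _).setReg _ _
      · simp [hcnt]
      · intro t ht
        have := hst.2 t (by simp at ht ⊢; omega)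
        rw [List.getElem_append_left ht] at this
        exact this
      · simpa [hcnt] using hread.1.2
      · simp [hcnt]; omega
      · simp [hcnt, hs.mem, hread.1.1]
    · omega
    refine WP.seq (wp_bestCode hb hw hlen fun s b hw hlen hxb hbest => ?_)
    have hload : (Expr.cell 3 (.reg xB) + .reg xL).val s = load b + I.scaledLength T := by
      simp [hxb, hlen, hw.holds.load]
    have hxb' : (Expr.reg xB).val s = b := hxb
    refine WP.seq (WP.store (fun _ => ?_) ?_)
    · rw [hload]
      have h1 : load b ≤ ∑ i, load i := Finset.single_le_sum (fun i _ => Nat.zero_le _)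
        (Finset.mem_univ b)
      rw [hg.sum_load] at h1
      omega
    rw [hload, hxb']
    refine wp_growCode hb (hw.setMem (Or.inl rfl) (hw.holds.setMem_load b _)) (hg.simple b) hxb
      fun s hw => ?_
    exact ⟨T :: l₂, _, _, by simpa using hl, hw.ready, hw.stack, hw.holds, hg.cons T b hbest⟩
  · rintro s ⟨l₂, load, tour, hl, hs, hst, hh, hg⟩
    refine ⟨by simpa using hst.1, hQ s load tour hs hh ?_⟩
    rw [hl]
    simpa using hg

/-! ### Output -/

theorem closeTour_eq_map {l : List (Fin I.n)} (h : I.Simple l) :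
    I.closeTour l = (List.range (I.n + 1)).map fun j => l.getD j I.r := by
  refine List.ext_getElem (by simp [length_closeTour h]) fun j h1 h2 => ?_
  rw [List.getElem_map, List.getElem_range, List.getD_eq_getElem?_getD]
  simp only [closeTour, List.getElem_append, List.getElem_replicate]
  split_ifs with hj
  · simp [hj]
  · simp [not_lt.1 hj]

/-- Following the links of a tour, and staying at the depot once it is reached. -/
theorem Represents.next {nx : Fin I.n → ℕ} {l : List (Fin I.n)} (h : Represents I nx l)
    (hl : I.Simple l) (j : ℕ) : (l.getD (j + 1) I.r ≠ I.r →
      nx (l.getD (j + 1) I.r) = l.getD (j + 2) I.r + 1) ∧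
    (l.getD (j + 1) I.r = I.r → l.getD (j + 2) I.r = I.r) := by
  constructor
  · intro hne
    have hj : j + 1 < l.length := by
      by_contra hj
      exact hne (by rw [List.getD_eq_getElem?_getD, List.getElem?_eq_none (by omega)]; rfl)
    rw [← h.2.getElem hj, List.getD_eq_getElem _ _ hj]
  · intro he
    -- The depot heads the list and occurs once, so meeting it at a positive index means that the
    -- end was passed.
    have hj : l.length ≤ j + 1 := by
      by_contra hj
      rw [List.getD_eq_getElem _ _ (by omega)] at he
      have h0 : l[0]'(by omega) = I.r := by
        have := hl.2
        rw [List.head?_eq_getElem?, List.getElem?_eq_getElem (by omega)] at this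
        exact Option.some_inj.1 this
      have := hl.1.getElem_inj_iff.1 (he.trans h0.symm)
      omega
    rw [List.getD_eq_getElem?_getD, List.getElem?_eq_none (by omega)]
    rfl

theorem Represents.next_depot {nx : Fin I.n → ℕ} {l : List (Fin I.n)} (h : Represents I nx l)
    (hl : I.Simple l) : nx I.r = l.getD 1 I.r + 1 := by
  cases l with
  | nil => simpa using hl.2
  | cons a l =>
    have ha : a = I.r := by simpa using hl.2
    have := h.2.getElem (j := 0) (by simp)
    simpa [ha] using this

/-- The part of the output for one vehicle. -/
def outTour (I : HTSP) (l : List (Fin I.n)) : List ℕ :=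
  (I.n + 1) :: (I.closeTour l).map Fin.val

theorem length_outTour {l : List (Fin I.n)} (h : I.Simple l) :
    (outTour I l).length = I.n + 2 := by
  simp [outTour, length_closeTour h]

theorem wp_emit {e : Expr} (hs : Ready I C s) (hh : Holds I load tour s)
    (hv : s.Bounded B → e.val s < 2 ^ B) (h0 : s.reg 0 + 1 < 2 ^ B)
    (hQ : ∀ s', Ready I C s' → Holds I load tour s' → output s' = output s ++ [e.val s] →
      (∀ x, x ≠ 0 → s'.reg x = s.reg x) → Q s') : WP B L (emit e) s Q :=
  WP.emit hv h0 (hQ _ ((hs.setMem _ _ (by simp)).setReg _ (by simp))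
    ((hh.setMem _ _ (by simp) (by simp)).setReg _ _) (output_emit s _) fun x hx => by simp [hx])

theorem wp_outputCode (hb : Budget I C B L) (hs : Ready I C s) (hh : Holds I load tour s)
    (hl : ∀ i, I.Simple (tour i))
    (hQ : ∀ s, output s = ((List.finRange I.k).flatMap fun i => outTour I (tour i)) → Q s) :
    WP B L outputCode s Q := by
  have hn := hb.n_le'
  have hk := hb.k_le
  have hlen : ∀ i ≤ I.k, (((List.finRange I.k).take i).flatMap fun i =>
      outTour I (tour i)).length = i * (I.n + 2) := by
    intro i hi
    rw [List.length_flatMap, List.map_congr_left (g := fun _ => I.n + 2)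
      (fun i _ => length_outTour (hl i))]
    simp [hi]
  -- Each vehicle contributes `n + 2` output entries, so output positions are quadratic in `L`;
  -- hence the square in `Budget.small`.
  have hbig : ∀ {i a : ℕ}, i < I.k → a ≤ i * (I.n + 2) + (I.n + 2) → a < 2 ^ B := by
    intro i a hi ha
    refine lt_of_le_of_lt ?_ hb.small
    calc a ≤ (i + 1) * (I.n + 2) := by linarith
      _ ≤ _ := by gcongr <;> omega
  refine WP.seq (WP.assign (fun _ => hb.lt (a := 0) (by omega)) ?_)
  refine WP.seq (WP.assign (fun _ => hb.lt (a := 0) (by omega)) ?_)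
  refine WP.loop_count (fun i s => Ready I C s ∧ Holds I load tour s ∧ s.reg 12 = i ∧
    output s = ((List.finRange I.k).take i).flatMap fun i => outTour I (tour i)) I.k hk ?_ ?_ ?_
  · exact ⟨(hs.setReg _ (by simp)).setReg _ (by simp), (hh.setReg _ _).setReg _ _, by simp,
      by simp [output]⟩
  · rintro i s hik ⟨hs, hh, hi, ho⟩
    have hs₀ := hs
    have hlo := hlen i hik.le
    have h0 : s.reg 0 = i * (I.n + 2) := by rw [← length_output, ho, hlo]
    have hsim := hl ⟨i, hik⟩
    have hol : ((List.finRange I.k).take i).flatMap (fun i => outTour I (tour i)) ++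
        outTour I (tour ⟨i, hik⟩) = ((List.finRange I.k).take (i + 1)).flatMap
          fun i => outTour I (tour i) := by
      rw [List.take_add_one, List.flatMap_append]
      simp [hik]
    have hrn := I.r.2
    generalize htour : tour ⟨i, hik⟩ = l at *
    generalize ((List.finRange I.k).take i).flatMap (fun i => outTour I (tour i)) = o at *
    refine ⟨by simp [hs.k, hi]; omega, ?_⟩
    refine WP.seq (wp_emit hs hh (fun _ => hb.lt ?_) (hbig hik (by omega)) fun s hs hh ho₁ hr => ?_)
    · simp [hs.n]; omega
    have h0₁ : s.reg 0 = i * (I.n + 2) + 1 := by rw [← length_output, ho₁]; simp [h0]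
    refine WP.seq (wp_emit hs hh (fun h => h.1 _) (hbig hik (by omega)) fun s' hs' hh' ho₂ hr' => ?_)
    have h0₂ : s'.reg 0 = i * (I.n + 2) + 2 := by rw [← length_output, ho₂]; simp [h0₁]
    have hi' : s'.reg 12 = i := by rw [hr' _ (by simp), hr _ (by simp), hi]
    have hrep := hh'.tour ⟨i, hik⟩
    rw [htour] at hrep
    have hnext : (HTSP.next xI xR - 1).val s' = l.getD 1 I.r := by
      have := hrep.next_depot hsim
      simp only [HTSP.next, val_sub, val_cell, val_add, val_mul, val_reg, val_ofNat, xI, xN, xR,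
        hi', hs'.n, hs'.r]
      rw [this, Nat.add_sub_cancel]
    refine WP.seq (WP.assign (fun _ => ?_) ?_)
    · rw [hnext]; exact hb.lt (by omega)
    refine WP.seq (WP.assign (fun h => h.1 _) ?_)
    refine WP.seq (WP.mono (Q := fun s => Ready I C s ∧ Holds I load tour s ∧ s.reg 12 = i ∧
      -- Entries up to index `j` of the padded tour have been emitted, and register 16 holds entry
      -- `j + 1`.
      output s = o ++ outTour I l) (WP.loop_count (fun j s => Ready I C s ∧ Holds I load tour s ∧
        s.reg 12 = i ∧ s.reg 14 = I.n - j ∧ s.reg 16 = l.getD (j + 1) I.r ∧ output s =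
          o ++ (I.n + 1) :: (List.range (j + 1)).map fun t => (l.getD t I.r : ℕ)) I.n hn ?_ ?_ ?_) ?_)
    · refine ⟨(hs'.setReg _ (by simp)).setReg _ (by simp), (hh'.setReg _ _).setReg _ _,
        by simpa using hi', by simp [hs'.n], by simpa using hnext, ?_⟩
      have h1 : output ((s'.setReg xV ((HTSP.next xI xR - 1).val s')).setReg xJ
          ((Expr.reg xN).val (s'.setReg xV ((HTSP.next xI xR - 1).val s')))) = output s' := by
        simp [output]
      have h2 : (l.getD 0 I.r) = I.r := by
        have := hsim.2
        cases l <;> simp_all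
      rw [h1, ho₂, ho₁, ho]
      simp [hs₀.n, hs.r, h2, -List.getD_eq_getElem?_getD]
    · rintro j s hj ⟨hs, hh, hi, hx, hv, hout⟩
      have hrep := hh.tour ⟨i, hik⟩
      rw [htour] at hrep
      refine ⟨by simp [hx]; omega, ?_⟩
      have h0 : s.reg 0 = i * (I.n + 2) + (j + 2) := by
        rw [← length_output, hout, List.length_append, hlo]; simp
      refine WP.seq (wp_emit hs hh (fun h => h.1 _) (hbig hik (by omega))
        fun s' hs' hh' ho' hr' => ?_)
      have hi' : s'.reg 12 = i := by rw [hr' _ (by simp), hi]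
      have hv' : s'.reg 16 = l.getD (j + 1) I.r := by rw [hr' _ (by simp), hv]
      have hx' : s'.reg 14 = I.n - j := by rw [hr' _ (by simp), hx]
      have hrep' := hh'.tour ⟨i, hik⟩
      rw [htour] at hrep'
      have hcond : (Expr.reg xV - .reg xR + (.reg xR - .reg xV)).val s' = 0 ↔
          l.getD (j + 1) I.r = I.r := by
        rw [← Fin.val_inj, ← hv', ← hs'.r]
        simp only [val_add, val_sub, val_reg, xV, xR]
        omega
      have hout' : output s' =
          o ++ (I.n + 1) :: (List.range (j + 1 + 1)).map fun t => (l.getD t I.r : ℕ) := by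
        rw [ho', hout, List.range_succ (n := j + 1), List.map_append, List.append_assoc,
          List.cons_append, val_reg, xV, hv]
        rfl
      refine WP.seq (WP.mono (Q := fun s => Ready I C s ∧ Holds I load tour s ∧ s.reg 12 = i ∧
        s.reg 14 = I.n - j ∧ s.reg 16 = l.getD (j + 2) I.r ∧ output s = output s')
        (WP.ite (fun h => ?_) (fun h => ?_)) ?_)
      · have h := (hrep'.next hsim j).1 (fun h' => h (hcond.2 h'))
        have hnext : (HTSP.next xI xV - 1).val s' = l.getD (j + 2) I.r := by
          simp only [HTSP.next, val_sub, val_cell, val_add, val_mul, val_reg, val_ofNat, xI, xN, xV,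
            hi', hs'.n, hv']
          rw [h, Nat.add_sub_cancel]
        refine WP.assign (fun _ => ?_) ⟨hs'.setReg _ (by simp), hh'.setReg _ _, by simpa using hi',
          by simpa using hx', by simpa using hnext, by simp [output]⟩
        rw [hnext]; exact hb.lt (by omega)
      · refine wp_skip ⟨hs', hh', hi', hx', ?_, rfl⟩
        rw [(hrep'.next hsim j).2 (hcond.1 h), hv', hcond.1 h]
      · rintro s ⟨hs, hh, hi, hx, hv, ho⟩
        refine WP.assign (fun _ => hb.lt ?_) ⟨hs.setReg _ (by simp), hh.setReg _ _, by simpa using hi,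
          ?_, by simpa using hv, ?_⟩
        · simp [hx]; omega
        · simp [hx]; omega
        · rw [← hout', ← ho]
          simp [output]
    · rintro s ⟨hs, hh, hi, hx, hv, hout⟩
      refine ⟨by simp [hx], hs, hh, hi, ?_⟩
      rw [hout, outTour, closeTour_eq_map hsim, List.map_map]
      rfl
    · rintro s ⟨hs, hh, hi, hout⟩
      refine WP.assign (fun _ => hb.lt ?_) ⟨hs.setReg _ (by simp), hh.setReg _ _, by simp [hi], ?_⟩
      · simp [hi]; omega
      · rw [← hol, ← hout]
        simp [output]
  · rintro s ⟨hs, hh, hi, ho⟩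
    refine ⟨by simp [hs.k, hi], hQ s ?_⟩
    rw [ho, List.take_of_length_le (by simp)]

/-! ## The main theorem -/

theorem wp_code (hb : Budget I C B L) :
    WP B L code (init (I.encodeInput C)) fun s => ∃ load tour, Greedy C.flatten load tour ∧
      output s = I.encodeTours fun i => I.closeTour (tour i) := by
  refine WP.seq (wp_denomCode hb rfl (fun a i ha => by simp [init, ha]) fun s hs hm hn hd hp => ?_)
  refine WP.seq (wp_headerCode hb hs hm hn hd hp fun s hs hm hp => ?_)
  refine WP.seq (wp_initToursCode hb hs hm fun s' hs' hp' hh => ?_)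
  refine WP.seq (wp_parseCode hb hs' hh (hp'.trans hp) fun s hs hh hst => ?_)
  refine WP.seq (wp_greedyCode hb hs hst hh fun s load tour hs hh hg => ?_)
  refine wp_outputCode hb hs hh hg.simple fun s ho => ⟨load, tour, hg, ?_⟩
  rw [ho, encodeTours]
  refine List.flatMap_congr fun i _ => ?_
  simp [outTour, length_closeTour (hg.simple i), List.map_eq_flatMap]

/-! ### Polynomial bounds on the size of the numbers -/

theorem scaled_le (u v : Fin I.n) : I.scaled u v ≤ (I.d u v).num.natAbs * I.denom :=
  Nat.mul_le_mul_left _ (Nat.div_le_self _ _)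

theorem prod_le_two_pow_bitLength (l : List ℕ) : l.prod ≤ 2 ^ bitLength l := by
  induction l with
  | nil => simp [bitLength]
  | cons a l ih =>
    have ha : a < 2 ^ (Nat.size a + 1) :=
      (Nat.lt_size_self a).trans_le (Nat.pow_le_pow_right (by simp) (by simp))
    rw [List.prod_cons, bitLength, List.map_cons, List.sum_cons, pow_add]
    exact Nat.mul_le_mul ha.le ih

theorem bitLength_sublist {l₁ l₂ : List ℕ} (h : l₁.Sublist l₂) : bitLength l₁ ≤ bitLength l₂ :=
  (h.map _).sum_le_sum fun _ _ => Nat.zero_le _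

theorem dens_sublist (l : List ℚ) : (l.map Rat.den).Sublist (l.flatMap encodeRat) := by
  induction l with
  | nil => simp
  | cons q l ih =>
    rw [List.map_cons, List.flatMap_cons, encodeRat]
    exact (ih.cons_cons _).cons _

theorem dists_sublist : (I.dists.flatMap encodeRat).Sublist (I.encodeInput C) := by
  rw [encodeInput_eq]
  exact (List.sublist_append_left _ _).cons _

/-- All denominators are written in the input, so the bit length of their product is bounded by the
sum of their bit lengths. -/
theorem denom_le : I.denom ≤ 2 ^ bitLength (I.encodeInput C) :=
  (prod_le_two_pow_bitLength _).trans (Nat.pow_le_pow_right (by simp)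
    (bitLength_sublist ((dens_sublist _).trans dists_sublist)))

theorem num_lt (u v : Fin I.n) : (I.d u v).num.natAbs < 2 ^ bitLength (I.encodeInput C) := by
  refine lt_two_pow_bitLength (dists_sublist.subset ?_)
  exact List.mem_flatMap.2 ⟨_, mem_dists u v, by simp [encodeRat]⟩

theorem scaled_le_two_pow (u v : Fin I.n) :
    I.scaled u v ≤ 2 ^ bitLength (I.encodeInput C) * 2 ^ bitLength (I.encodeInput C) :=
  (scaled_le u v).trans (Nat.mul_le_mul (num_lt u v).le denom_le)

theorem length_flatten_flatten_le (C : I.Collection) :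
    C.flatten.flatten.length ≤ (C.flatMap I.encodeClass).length := by
  have h : ∀ 𝒯 : List I.EdgeList, 𝒯.flatten.length ≤ (𝒯.flatMap I.encodeTree).length := by
    intro 𝒯
    induction 𝒯 with
    | nil => simp
    | cons T 𝒯 ih =>
      rw [List.flatten_cons, List.flatMap_cons, List.length_append, List.length_append,
        encodeTree_eq, List.length_cons, length_flatMap_ends]
      omega
  induction C with
  | nil => simp
  | cons 𝒯 C ih =>
    have := h 𝒯
    rw [List.flatten_cons, List.flatten_append, List.flatMap_cons, List.length_append,
      List.length_append, encodeClass, List.length_cons]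
    omega

/-- The first factor bounds the number of edges, each of which occupies space in the input; the
other two bound a numerator and the common denominator. -/
theorem total_le (C : I.Collection) : (C.flatten.map I.scaledLength).sum ≤
    bitLength (I.encodeInput C) *
      (2 ^ bitLength (I.encodeInput C) * 2 ^ bitLength (I.encodeInput C)) := by
  have h1 : ∀ l : List I.EdgeList, (l.map I.scaledLength).sum =
      (l.flatten.map fun e => I.scaled e.1 e.2).sum := by
    intro l
    induction l with
    | nil => rfl
    | cons T l ih =>
      rw [List.map_cons, List.sum_cons, ih, List.flatten_cons, List.map_append, List.sum_append]
      rfl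
  have h2 := List.sum_le_card_nsmul (C.flatten.flatten.map fun e => I.scaled e.1 e.2)
    (2 ^ bitLength (I.encodeInput C) * 2 ^ bitLength (I.encodeInput C)) (by
      intro x hx
      obtain ⟨e, -, rfl⟩ := List.mem_map.1 hx
      exact scaled_le_two_pow _ _)
  have h3 := length_flatten_flatten_le C
  have h4 := length_encodeInput (C := C)
  have h5 := length_le_bitLength (I.encodeInput C)
  rw [h1]
  refine h2.trans ?_
  rw [smul_eq_mul, List.length_map]
  exact Nat.mul_le_mul_right _ (by omega)

theorem budget (C : I.Collection) :
    Budget I C (3 * bitLength (I.encodeInput C)) (bitLength (I.encodeInput C)) := by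
  have hS : 2 ≤ bitLength (I.encodeInput C) := by
    have h4 := length_encodeInput (C := C)
    have h5 := length_le_bitLength (I.encodeInput C)
    omega
  have hlt := Nat.lt_two_pow_self (n := bitLength (I.encodeInput C))
  have h4 : 2 ^ 2 ≤ 2 ^ bitLength (I.encodeInput C) := Nat.pow_le_pow_right (by simp) hS
  have hcube : 2 ^ (3 * bitLength (I.encodeInput C)) = 2 ^ bitLength (I.encodeInput C) *
      (2 ^ bitLength (I.encodeInput C) * 2 ^ bitLength (I.encodeInput C)) := by
    ring
  refine ⟨length_le_bitLength _, ?_, ?_, ?_⟩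
  · rw [hcube]
    generalize 2 ^ bitLength (I.encodeInput C) = N at *
    -- With `N = 2 ^ S` one has `S < N` and `4 ≤ N`, so `S + 2 < 2 * N`.
    calc _ < (2 * N) * (2 * N) := Nat.mul_self_lt_mul_self (by omega)
      _ = 4 * (N * N) := by ring
      _ ≤ _ := Nat.mul_le_mul_right _ h4
  · exact (denom_le (C := C)).trans_lt (Nat.pow_lt_pow_right (by simp) (by omega))
  · rw [hcube]
    exact (total_le C).trans_lt (Nat.mul_lt_mul_of_pos_right hlt (by positivity))

end HTSP

theorem mainTheorem3 :
    ∃ (P : RAM.Prog) (p : Polynomial ℕ),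
      ∀ (I : HTSP) (C : I.Collection) (M α β : ℝ), 0 ≤ M → 0 ≤ α → 0 ≤ β →
        I.Assignable M α β C →
        ∃ (τ : Fin I.k → List (Fin I.n)) (t : ℕ),
          RAM.Runs P (I.encodeInput C) (I.encodeTours τ) t ∧
          t ≤ p.eval (RAM.bitLength (I.encodeInput C)) ∧
          I.IsSolution τ ∧
          I.makespan τ ≤ (4 * α + 2 * β) * M ∧
          ∀ c : ℝ, M ≤ c * I.opt → I.IsApprox (c * (4 * α + 2 * β)) τ := by
  obtain ⟨f, hf⟩ := HTSP.code.exists_polynomial_weight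
  -- `3 * X + 1` is `B + 1` for `B = 3 S`; it multiplies the weight of the program and a bound `S (S
  -- + 2)` on the output length `k (n + 2)`.
  refine ⟨HTSP.code, (f + .X * (.X + 2)) * (3 * .X + 1), ?_⟩
  intro I C M α β hM hα hβ hC
  have hb := HTSP.budget C
  obtain ⟨s, t, hexec, ht, hs, load, tour, hg, ho⟩ := HTSP.wp_code hb
    (RAM.bounded_init (by omega))
  have hsol := hg.isSolution hC
  have hmake := hg.makespan_le hM hα hβ hC
  refine ⟨fun i => I.closeTour (tour i), _, ⟨s, t, hexec, ho, rfl⟩, ?_, hsol, hmake, ?_⟩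
  · have hlen : (I.encodeTours fun i => I.closeTour (tour i)).length = I.k * (I.n + 2) := by
      rw [HTSP.encodeTours, List.length_flatMap, List.map_congr_left (g := fun _ => I.n + 2)]
      · simp
      · intro i _
        simp [HTSP.length_closeTour (hg.simple i)]
    have hbit := RAM.bitLength_le (B := 3 * RAM.bitLength (I.encodeInput C))
      (l := I.encodeTours fun i => I.closeTour (tour i)) (by
        intro a ha
        rw [← ho, RAM.output] at ha
        obtain ⟨i, -, rfl⟩ := List.mem_map.1 ha
        exact hs.2 _ _)
    have hle : I.k * (I.n + 2) ≤
        RAM.bitLength (I.encodeInput C) * (RAM.bitLength (I.encodeInput C) + 2) :=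
      Nat.mul_le_mul hb.k_le (Nat.add_le_add_right hb.n_le' 2)
    rw [hlen] at hbit
    simp only [Polynomial.eval_mul, Polynomial.eval_add, Polynomial.eval_X, Polynomial.eval_ofNat,
      Polynomial.eval_one, hf, add_mul]
    rw [← add_mul] 
    nlinarith [Nat.mul_le_mul_right (3 * RAM.bitLength (I.encodeInput C) + 1) hle]
  · intro c hc
    refine ⟨hsol, hmake.trans ?_⟩
    have : 0 ≤ 4 * α + 2 * β := by positivity
    calc (4 * α + 2 * β) * M ≤ (4 * α + 2 * β) * (c * I.opt) := by gcongr
      _ = _ := by ring
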